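/- Let $W$ be a finite Coxeter group with set of simple generators $S$ and length function $\ell$, partially ordered by the (right) weak order: the partial order $\le$ generated by the relations $w\le ws$ for $w\in W$, $s\in S$ with $\ell(w)<\ell(ws)$. For $J\subseteq S$ let $W_J$ be the subgroup generated by $J$, and for $w\in W$ let $w_J\in W_J$ be the first factor in the unique factorization $w=w_J\cdot u$ with $w_J\in W_J$ and $\ell(su)>\ell(u)$ for all $s\in J$. A Coxeter element of $W_J$ is a product of the elements of $J$, each taken exactly once, in some order; an initial letter of it is the first letter of some reduced word for it in the generators $J$. Let $c$ be a Coxeter element of $W$ and let $a_1a_2\cdots a_n$, $n=|S|$, be a word for $c$ in which each simple generator occurs exactly once. The $c$-sorting word of $w\in W$ is the lexicographically first (as a sequence of positions) subword of $c^\infty=a_1\cdots a_n\,|\,a_1\cdots a_n\,|\cdots$ which is a reduced word for $w$; and $w$ is $c$-sortable if the sets of letters of this word lying in the successive copies of $a_1\cdots a_n$ form a weakly decreasing sequence under inclusion. (This does not depend on the choice of the word $a_1\cdots a_n$ for $c$.) For $J\subseteq S$, a Coxeter element $c$ of $W_J$ and $w\in W_J$, define $\pi_\downarrow^c(w)$ recursively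 by $\pi_\downarrow^c(1)=1$ and, for any initial letter $s$ of $c$, $$\pi_\downarrow^c(w)=\begin{cases} s\cdot\pi_\downarrow^{scs}(sw) & \text{if } \ell(sw)<\ell(w),\\ \pi_\downarrow^{sc}\bigl(w_{J\setminus\{s\}}\bigr) & \text{if } \ell(sw)>\ell(w),\end{cases}$$ where $scs$ is regarded as a Coxeter element of $W_J$ and $sc$ as a Coxeter element of $W_{J\setminus\{s\}}$. A priori the result depends on the choice of an initial letter at each step. **Proposition.** Let $c$ be a Coxeter element of the finite Coxeter group $W$. Then $\pi_\downarrow^c:W\to W$ is well defined: for each $w\in W$ the recursion yields exactly one value $\pi_\downarrow^c(w)$, whatever initial letters are chosen. Moreover, for every $w\in W$, $\pi_\downarrow^c(w)$ is the unique maximal $c$-sortable element weakly below $w$; that is, $\pi_\downarrow^c(w)$ is $c$-sortable, $\pi_\downarrow^c(w)\le w$, every $c$-sortable $x\le w$ satisfies $x\le\pi_\downarrow^c(w)$, and no other $c$-sortable element below $w$ is maximal among these. Furthermore $\pi_\downarrow^c\circ\pi_\downarrow^c=\pi_\downarrow^c$, and $x\le y$ implies $\pi_\downarrow^c(x)\le\pi_\downarrow^c(y)$.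 -/

import Mathlib

namespace CoxeterSystem

/-- The (right) weak order: the reflexive transitive closure of the relations `v < v * s`
for `s` a simple generator with `ℓ v < ℓ (v * s)`. -/
def WeakLE {B W : Type*} [Group W] {M : CoxeterMatrix B} (cs : CoxeterSystem M W) :
    W → W → Prop :=
  Relation.ReflTransGen fun v w => ∃ i : B, w = v * cs.simple i ∧ cs.length v < cs.length w

/-- The standard parabolic subgroup `W_J` generated by the simple generators indexed by `J`. -/
def parabolic {B W : Type*} [Group W] {M : CoxeterMatrix B} (cs : CoxeterSystem M W)
    (J : Set B) : Subgroup W :=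
  Subgroup.closure (cs.simple '' J)

/-- `u = w_J`: the unique factorization `w = u * u'` has `u ∈ W_J` and `ℓ (s * u') > ℓ u'` for
all `s ∈ J`. -/
def IsParabolicPart {B W : Type*} [Group W] {M : CoxeterMatrix B} (cs : CoxeterSystem M W)
    (J : Set B) (w u : W) : Prop :=
  u ∈ cs.parabolic J ∧
    ∃ u' : W, w = u * u' ∧ ∀ i ∈ J, cs.length u' < cs.length (cs.simple i * u')

/-- `a` is a word for the Coxeter element `c` of `W_J`: it uses each letter of `J` exactly once,
no other letter, and its product is `c`. -/
structure IsCoxeterWord {B W : Type*} [Group W] {M : CoxeterMatrix B} (cs : CoxeterSystem M W)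
    (J : Set B) (c : W) (a : List B) : Prop where
  nodup : a.Nodup
  mem_iff : ∀ i : B, i ∈ a ↔ i ∈ J
  prod_eq : cs.wordProd a = c

/-- `c` is a Coxeter element of the standard parabolic subgroup `W_J`
(of `W` itself when `J = Set.univ`). -/
def IsCoxeterElement {B W : Type*} [Group W] {M : CoxeterMatrix B} (cs : CoxeterSystem M W)
    (J : Set B) (c : W) : Prop :=
  ∃ a : List B, cs.IsCoxeterWord J c a

/-- `i` is an initial letter of `c` in `W_J`: the first letter of a reduced word for `c` in the
generators of `W_J`. -/
def IsInitialLetter {B W : Type*} [Group W] {M : CoxeterMatrix B} (cs : CoxeterSystem M W)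
    (J : Set B) (c : W) (i : B) : Prop :=
  ∃ ω : List B, (∀ j ∈ i :: ω, j ∈ J) ∧ cs.IsReduced (i :: ω) ∧ cs.wordProd (i :: ω) = c

/-- Positions in the half-infinite word `a | a | a | ⋯`: the pair `(k, r)` is the `r`-th letter of
the `k`-th copy of `a`, and positions are ordered from left to right. -/
abbrev Position {B : Type*} (a : List B) : Type := ℕ ×ₗ Fin a.length

/-- The word read off from a sequence of positions. -/
def positionsWord {B : Type*} (a : List B) (p : List (Position a)) : List B :=
  p.map fun x => a.get (ofLex x).2

/-- `p` is a subword of `a | a | a | ⋯` (as an increasing sequence of positions) which is a reduced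
word for `w`. -/
structure IsReducedSubword {B W : Type*} [Group W] {M : CoxeterMatrix B}
    (cs : CoxeterSystem M W) (a : List B) (w : W) (p : List (Position a)) : Prop where
  increasing : p.Pairwise (· < ·)
  reduced : cs.IsReduced (positionsWord a p)
  prod_eq : cs.wordProd (positionsWord a p) = w

/-- `p` is the sorting word of `w` with respect to `a`: the lexicographically first subword (as a
sequence of positions) of `a | a | a | ⋯` which is a reduced word for `w`. -/
def IsSortingWord {B W : Type*} [Group W] {M : CoxeterMatrix B} (cs : CoxeterSystem M W)
    (a : List B) (w : W) (p : List (Position a)) : Prop :=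
  cs.IsReducedSubword a w p ∧
    ∀ q : List (Position a), cs.IsReducedSubword a w q → p = q ∨ List.Lex (· < ·) p q

/-- The set of letters of `p` that lie in the `k`-th copy of `a`. -/
def block {B : Type*} (a : List B) (p : List (Position a)) (k : ℕ) : Set B :=
  {i | ∃ r : Fin a.length, toLex (k, r) ∈ p ∧ a.get r = i}

/-- `w` is `c`-sortable: the sequence of subsets defined by its `c`-sorting word, formed with a word
`a` for the Coxeter element `c` of `W`, is weakly decreasing under inclusion. (The choice of `a` is
immaterial, as two such words for `c` differ by commutations of letters.) -/
def IsSortable {B W : Type*} [Group W] {M : CoxeterMatrix B} (cs : CoxeterSystem M W)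
    (c w : W) : Prop :=
  ∃ a : List B, cs.IsCoxeterWord Set.univ c a ∧
    ∃ p : List (Position a), cs.IsSortingWord a w p ∧
      ∀ k : ℕ, block a p (k + 1) ⊆ block a p k

/-- The recursion for the downward projection. `cs.PiDown J c w v` says that `v` is a value of
`π↓^c (w)`, for `c` a Coxeter element of `W_J` and `w ∈ W_J`, obtained from the recursion with some
choice of an initial letter `s` at each step:
`π↓^c (1) = 1`, `π↓^c (w) = s * π↓^{scs} (s * w)` if `ℓ (s * w) < ℓ w`, and
`π↓^c (w) = π↓^{sc} (w_{J ∖ {s}})` if `ℓ (s * w) > ℓ w`, where `sc` is regarded as a Coxeter element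
of `W_{J ∖ {s}}`. -/
inductive PiDown {B W : Type*} [Group W] {M : CoxeterMatrix B} (cs : CoxeterSystem M W) :
    Set B → W → W → W → Prop
  | one (J : Set B) (c : W) : PiDown cs J c 1 1
  | shorten (J : Set B) (c w v : W) (i : B) (hi : cs.IsInitialLetter J c i)
      (hw : cs.length (cs.simple i * w) < cs.length w)
      (h : PiDown cs J (cs.simple i * c * cs.simple i) (cs.simple i * w) v) :
      PiDown cs J c w (cs.simple i * v)
  | restrict (J : Set B) (c w u v : W) (i : B) (hi : cs.IsInitialLetter J c i)
      (hw : cs.length w < cs.length (cs.simple i * w))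
      (hu : cs.IsParabolicPart (J \ {i}) w u)
      (h : PiDown cs (J \ {i}) (cs.simple i * c) u v) :
      PiDown cs J c w v

end CoxeterSystem

/-! Weak order is containment of inversion sets in the geometric representation
(`weakLE_iff_inversions_subset`), so everything becomes a statement about sets of positive roots. A
Coxeter element orients the rank two root subsystems through ω, the antisymmetrized Euler form. An
element is `Aligned` when its inversions respect the orientation: if a positive combination of
positive roots β, γ with ω(β, γ) > 0 is an inversion, then so is β.

Three facts carry the proof.

Alignment is sortability. A first letter s carries the Euler form of a word to that of the rotated
word (`eulerForm_rotate`), so alignment follows the recursion for sortable elements when s is an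
inversion. When it is not, `Aligned.geomRep_simpleRoot_not_mem` forces the element into the
parabolic subgroup omitting s. This gives `Aligned.recSortable`; the greedy description of sorting
words then gives `isSortable_iff_aligned`.

A minimal upper bound of two aligned elements is aligned (`aligned_of_coversIn`). Hence the aligned
elements below w have a largest member (`exists_max_aligned`).

This largest member obeys both clauses of the recursion (`IsMaxAligned.shorten`,
`IsMaxAligned.restrict`) for every initial letter, because alignment depends on the Coxeter element
only and not on its word. So every value of the recursion is that maximum (`PiDown.isMaxAligned`),
while existence of a value is termination (`exists_piDown`). Idempotence and monotonicity are formal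
properties of a largest element. -/

/-- Twice the value of the canonical bilinear form of a Coxeter matrix on two simple roots. -/
noncomputable def CoxeterMatrix.pairing {B : Type*} (M : CoxeterMatrix B) (i j : B) : ℝ :=
  -2 * Real.cos (Real.pi / M i j)

/-- Twice the canonical symmetric bilinear form of a Coxeter matrix. -/
noncomputable def CoxeterMatrix.form {B : Type*} (M : CoxeterMatrix B) :
    (B →₀ ℝ) →ₗ[ℝ] (B →₀ ℝ) →ₗ[ℝ] ℝ :=
  Finsupp.linearCombination ℝ fun i => Finsupp.linearCombination ℝ fun j => M.pairing i j

/-! ### The canonical form, its reflections and the braid relations -/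

namespace CoxeterMatrix

variable {B : Type*} (M : CoxeterMatrix B)

theorem pairing_self (i : B) : M.pairing i i = 2 := by
  simp [pairing]

theorem pairing_comm (i j : B) : M.pairing i j = M.pairing j i := by
  simp [pairing, M.symmetric i j]

theorem eq_zero_or_two_le {i j : B} (h : i ≠ j) : M i j = 0 ∨ 2 ≤ M i j := by
  have := M.off_diagonal i j h
  omega

/-- The entry 0 encodes infinite order, and π / 0 = 0 turns the formula into −2 cos 0, which is the
customary value. -/
theorem pairing_of_eq_zero {i j : B} (h : M i j = 0) : M.pairing i j = -2 := by
  simp [pairing, h]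

theorem pairing_nonpos {i j : B} (h : i ≠ j) : M.pairing i j ≤ 0 := by
  rcases M.eq_zero_or_two_le h with h0 | h2
  · rw [M.pairing_of_eq_zero h0]; norm_num
  · have h2' : (2 : ℝ) ≤ M i j := by exact_mod_cast h2
    have : 0 ≤ Real.cos (Real.pi / M i j) := by
      apply Real.cos_nonneg_of_mem_Icc
      constructor
      · have : 0 ≤ Real.pi / M i j := by positivity
        linarith [Real.pi_pos]
      · exact div_le_div_of_nonneg_left Real.pi_pos.le (by norm_num) h2'
    unfold pairing
    linarith

theorem eq_two_of_pairing_eq_zero {i j : B} (h : i ≠ j) (h0 : M.pairing i j = 0) : M i j = 2 := by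
  rcases M.eq_zero_or_two_le h with hz | h2
  · rw [M.pairing_of_eq_zero hz] at h0; norm_num at h0
  · by_contra hne
    have h3 : 3 ≤ M i j := by omega
    have h3' : (3 : ℝ) ≤ M i j := by exact_mod_cast h3
    have : 0 < Real.cos (Real.pi / M i j) := by
      apply Real.cos_pos_of_mem_Ioo
      constructor
      · have : 0 ≤ Real.pi / M i j := by positivity
        linarith [Real.pi_pos]
      · calc Real.pi / M i j ≤ Real.pi / 3 :=
              div_le_div_of_nonneg_left Real.pi_pos.le (by norm_num) h3'
          _ < Real.pi / 2 := by linarith [Real.pi_pos]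
    unfold pairing at h0
    linarith

/-- The simple root indexed by `i`. -/
noncomputable abbrev simpleRoot (i : B) : B →₀ ℝ := Finsupp.single i 1

@[simp] theorem form_single (i j : B) (a b : ℝ) :
    M.form (Finsupp.single i a) (Finsupp.single j b) = a * (b * M.pairing i j) := by
  simp [form]

theorem form_comm (x y : B →₀ ℝ) : M.form x y = M.form y x := by
  have : M.form = M.form.flip := by
    ext i j
    simp [M.pairing_comm i j]
  exact congrArg (fun f => f x y) this

theorem form_simpleRoot_self (i : B) :
    M.form (simpleRoot i) (simpleRoot i) = 2 := by
  simp [M.pairing_self]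

/-- The reflection in a simple root. -/
noncomputable def simpleReflection (i : B) : (B →₀ ℝ) ≃ₗ[ℝ] (B →₀ ℝ) :=
  Module.reflection (M.form_simpleRoot_self i)

theorem simpleReflection_apply (i : B) (x : B →₀ ℝ) :
    M.simpleReflection i x = x - M.form (simpleRoot i) x • simpleRoot i := by
  simp [simpleReflection, Module.reflection_apply]

-- On the plane of the two roots the product is a rotation by φ = 2π/m, and powers of a product of
-- two reflections are given by Chebyshev polynomials at 2 cos φ. The case m = 2 is separate because
-- sin φ then vanishes.
open Polynomial Polynomial.Chebyshev in
theorem simpleReflection_mul_pow (i j : B) :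
    (M.simpleReflection i * M.simpleReflection j) ^ M i j = 1 := by
  by_cases hij : i = j
  · subst hij
    ext x : 1
    simp [simpleReflection, Module.involutive_reflection (M.form_simpleRoot_self i) _]
  rcases M.eq_zero_or_two_le hij with h0 | h2
  · simp [h0]
  apply LinearEquiv.ext
  intro z
  unfold simpleReflection
  set m := M i j with hm
  set φ : ℝ := 2 * Real.pi / m with hφ
  have hm0 : (m : ℝ) ≠ 0 := by positivity
  have ht : M.form (simpleRoot i) (simpleRoot j) * M.form (simpleRoot j) (simpleRoot i) - 2
      = 2 * Real.cos φ := by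
    have : φ = 2 * (Real.pi / m) := by rw [hφ]; ring
    rw [this, Real.cos_two_mul]
    simp [pairing, M.symmetric j i, ← hm]
    ring
  rcases Nat.eq_or_lt_of_le h2 with h2 | h3
  · have hk : M.pairing i j = 0 := by simp [pairing, ← hm, ← h2]
    have hk' : M.pairing j i = 0 := by rw [pairing_comm, hk]
    rw [← h2, pow_two]
    simp only [LinearEquiv.mul_apply, Module.reflection_apply, map_sub, map_smul,
      form_single, hk, hk', M.pairing_self, LinearEquiv.coe_one, id]
    simp only [mul_zero]
    module
  · have hsin : Real.sin φ ≠ 0 := by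
      apply ne_of_gt
      apply Real.sin_pos_of_pos_of_lt_pi
      · positivity
      · rw [hφ, div_lt_iff₀ (by positivity)]
        have : (3 : ℝ) ≤ m := by exact_mod_cast h3
        nlinarith [Real.pi_pos]
    have hS (n : ℤ) : (S ℝ n).eval (2 * Real.cos φ) = Real.sin ((n + 1) * φ) / Real.sin φ := by
      rw [eq_div_iff hsin, S_two_mul_real_cos]
    rw [Module.reflection_mul_reflection_pow_apply _ _ m z (2 * Real.cos φ) ht.symm]
    -- Every correction term has a vanishing factor: S_{h-1} for m = 2h, since hφ = π, and S_h +
    -- S_{h-1} for m = 2h + 1, since (h + 1)φ = 2π − hφ.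
    rcases Nat.even_or_odd' m with ⟨h, hh | hh⟩
    · have e1 : ((m : ℤ) - 2) / 2 = h - 1 := by omega
      have e2 : ((m : ℤ) - 1) / 2 = h - 1 := by omega
      have hz : (S ℝ ((h : ℤ) - 1)).eval (2 * Real.cos φ) = 0 := by
        rw [hS]
        have : ((((h : ℤ) - 1 : ℤ) : ℝ) + 1) * φ = Real.pi := by
          have : (m : ℝ) = 2 * h := by rw [hh]; push_cast; ring
          rw [hφ]; push_cast; field_simp; rw [this]; ring
        rw [this]; simp
      rw [e1, e2, hz]
      simp
    · have e1 : ((m : ℤ) - 2) / 2 = h - 1 := by omega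
      have e2 : ((m : ℤ) - 1) / 2 = h := by omega
      have e3 : ((m : ℤ) - 3) / 2 = h - 1 := by omega
      have e4 : (m : ℤ) / 2 = h := by omega
      have hz : (S ℝ (h : ℤ)).eval (2 * Real.cos φ)
          + (S ℝ ((h : ℤ) - 1)).eval (2 * Real.cos φ) = 0 := by
        rw [hS, hS, ← add_div]
        have hmr : (m : ℝ) = 2 * h + 1 := by rw [hh]; push_cast; ring
        have : ((h : ℤ) + 1 : ℝ) * φ = 2 * Real.pi - (((((h : ℤ) - 1 : ℤ) : ℝ) + 1) * φ) := by
          rw [hφ]; push_cast; field_simp; rw [hmr]; ring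
        rw [this, Real.sin_two_pi_sub]; simp
      rw [e1, e2, e3, e4, hz]
      simp

/-! ### Coefficients of dihedral roots -/

/-- The coefficients of the roots of a dihedral root system, by the length of the word. -/
def dihedralCoeff (k : ℝ) : ℕ → ℝ
  | 0 => 0
  | 1 => 1
  | n + 2 => -k * dihedralCoeff k (n + 1) - dihedralCoeff k n

theorem dihedralCoeff_mul_sin (θ : ℝ) (n : ℕ) :
    dihedralCoeff (-2 * Real.cos θ) n * Real.sin θ = Real.sin (n * θ) := by
  induction n using Nat.twoStepInduction with
  | zero => simp [dihedralCoeff]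
  | one => simp [dihedralCoeff]
  | more n ih1 ih2 =>
    rw [dihedralCoeff, sub_mul, ih1, mul_assoc, ih2]
    push_cast
    rw [show (n + 2 : ℝ) * θ = (n + 1) * θ + θ by ring,
      show (n : ℝ) * θ = (n + 1) * θ - θ by ring, Real.sin_add, Real.sin_sub]
    ring

/-- The coefficient is sin(nθ)/sin θ with θ = π/m, and nθ ≤ π as long as n ≤ m. For infinite m it
degenerates to n. -/
theorem dihedralCoeff_nonneg {i j : B} (h : i ≠ j) {n : ℕ} (hn : M i j ≠ 0 → n ≤ M i j) :
    0 ≤ dihedralCoeff (M.pairing i j) n := by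
  rcases M.eq_zero_or_two_le h with h0 | h2
  · rw [M.pairing_of_eq_zero h0]
    suffices dihedralCoeff (-2) n = n by rw [this]; positivity
    clear hn
    induction n using Nat.twoStepInduction with
    | zero => simp [dihedralCoeff]
    | one => simp [dihedralCoeff]
    | more n ih1 ih2 =>
      rw [dihedralCoeff, ih1, ih2]; push_cast; ring
  · have hn' : n ≤ M i j := hn (by omega)
    have hm : (2 : ℝ) ≤ M i j := by exact_mod_cast h2
    have hθ : 0 < Real.pi / M i j := by positivity
    have hsin : 0 < Real.sin (Real.pi / M i j) := by
      apply Real.sin_pos_of_pos_of_lt_pi hθ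
      rw [div_lt_iff₀ (by positivity)]
      nlinarith [Real.pi_pos]
    have key := dihedralCoeff_mul_sin (Real.pi / M i j) n
    have : 0 ≤ Real.sin (n * (Real.pi / M i j)) := by
      apply Real.sin_nonneg_of_nonneg_of_le_pi (by positivity)
      have : (n : ℝ) ≤ M i j := by exact_mod_cast hn'
      calc n * (Real.pi / M i j) ≤ M i j * (Real.pi / M i j) := by gcongr
        _ = Real.pi := by field_simp
    rw [← key] at this
    exact nonneg_of_mul_nonneg_left this hsin

end CoxeterMatrix

/-! ### The geometric representation and positivity of roots -/

namespace CoxeterSystem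

open CoxeterMatrix (simpleRoot)

variable {B W : Type*} [Group W] {M : CoxeterMatrix B} (cs : CoxeterSystem M W)

theorem isLiftable_simpleReflection : M.IsLiftable fun i =>
    LinearEquiv.automorphismGroup.toLinearMapMonoidHom (M.simpleReflection i) := by
  intro i j
  rw [← map_mul, ← map_pow, M.simpleReflection_mul_pow i j, map_one]

/-- The geometric representation of a Coxeter group. -/
noncomputable def geomRep : W →* Module.End ℝ (B →₀ ℝ) :=
  cs.lift ⟨_, isLiftable_simpleReflection⟩

theorem geomRep_simple (i : B) (x : B →₀ ℝ) :
    cs.geomRep (cs.simple i) x = x - M.form (simpleRoot i) x • simpleRoot i := by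
  rw [geomRep, lift_apply_simple]
  exact M.simpleReflection_apply i x

theorem geomRep_simple_single (i j : B) :
    cs.geomRep (cs.simple i) (simpleRoot j) = simpleRoot j - M.pairing i j • simpleRoot i := by
  simp [geomRep_simple]

theorem geomRep_simple_self (i : B) :
    cs.geomRep (cs.simple i) (simpleRoot i) = -simpleRoot i := by
  rw [geomRep_simple, M.form_simpleRoot_self]; module

theorem geomRep_mul (v w : W) (x : B →₀ ℝ) :
    cs.geomRep (v * w) x = cs.geomRep v (cs.geomRep w x) := by
  rw [map_mul]; rfl

@[simp] theorem geomRep_one (x : B →₀ ℝ) : cs.geomRep 1 x = x := by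
  rw [map_one]; rfl

@[simp] theorem geomRep_inv_apply (w : W) (x : B →₀ ℝ) :
    cs.geomRep w⁻¹ (cs.geomRep w x) = x := by
  rw [← geomRep_mul]; simp

@[simp] theorem geomRep_apply_inv (w : W) (x : B →₀ ℝ) :
    cs.geomRep w (cs.geomRep w⁻¹ x) = x := by
  rw [← geomRep_mul]; simp

@[simp] theorem geomRep_simple_simple (i : B) (x : B →₀ ℝ) :
    cs.geomRep (cs.simple i) (cs.geomRep (cs.simple i) x) = x := by
  rw [← geomRep_mul]; simp

theorem form_geomRep (w : W) (x y : B →₀ ℝ) :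
    M.form (cs.geomRep w x) (cs.geomRep w y) = M.form x y := by
  induction w using cs.simple_induction_left with
  | one => simp
  | mul_simple_left w i ih =>
    rw [geomRep_mul, geomRep_mul, ← ih, geomRep_simple, geomRep_simple]
    simp only [map_sub, map_smul, LinearMap.sub_apply, LinearMap.smul_apply,
      M.form_simpleRoot_self, smul_eq_mul]
    rw [M.form_comm _ (simpleRoot i)]
    ring

theorem geomRep_alternatingWord (n : ℕ) (i j : B) :
    cs.geomRep (cs.wordProd (alternatingWord i j n)) (simpleRoot i) =
      if Even n then CoxeterMatrix.dihedralCoeff (M.pairing i j) (n + 1) • simpleRoot i +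
          CoxeterMatrix.dihedralCoeff (M.pairing i j) n • simpleRoot j
        else CoxeterMatrix.dihedralCoeff (M.pairing i j) n • simpleRoot i +
          CoxeterMatrix.dihedralCoeff (M.pairing i j) (n + 1) • simpleRoot j := by
  induction n using Nat.twoStepInduction generalizing i j with
  | zero => simp [alternatingWord, CoxeterMatrix.dihedralCoeff]
  | one =>
    simp [alternatingWord, CoxeterMatrix.dihedralCoeff, geomRep_simple_single,
      M.pairing_comm j i, sub_eq_add_neg]
  | more n ih1 ih2 =>
    rw [alternatingWord_succ, wordProd_concat, geomRep_mul, geomRep_simple_single, map_sub,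
      map_smul, ih2 j i, alternatingWord_succ, wordProd_concat, geomRep_mul, geomRep_simple_self,
      map_neg, ih1 i j, M.pairing_comm j i]
    simp only [Nat.even_add_one, not_not]
    by_cases h : Even n
    · simp only [h, if_true, not_true, if_false, CoxeterMatrix.dihedralCoeff]
      module
    · simp only [h, if_true, not_false_eq_true, if_false, CoxeterMatrix.dihedralCoeff]
      module

/-- Split off from w the longest alternating suffix in i and j, where j is a right descent. The
remaining factor v has neither letter as a right descent, so induction makes vα_i and vα_j
nonnegative; wα_i combines them with dihedral coefficients, which are nonnegative because the suffix
is shorter than m. -/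
theorem geomRep_simpleRoot_nonneg {w : W} {i : B} (h : cs.length w < cs.length (w * cs.simple i)) :
    0 ≤ cs.geomRep w (simpleRoot i) := by
  induction hN : cs.length w using Nat.strong_induction_on generalizing w i with
  | _ N IH =>
  subst hN
  by_cases hw : w = 1
  · subst hw; simp
  obtain ⟨j, hj⟩ := cs.exists_rightDescent_of_ne_one hw
  have hij : i ≠ j := by
    rintro rfl
    exact absurd hj (by unfold IsRightDescent; omega)
  classical
  -- the longest alternating suffix ending in `j` that splits off length-additively
  let P : ℕ → Prop := fun k => ∃ v : W, w = v * cs.wordProd (alternatingWord i j k) ∧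
    cs.length w = cs.length v + k
  have hP1 : P 1 := ⟨w * cs.simple j, by simp [alternatingWord], by
    have := cs.isRightDescent_iff.1 hj; omega⟩
  have hbound : ∀ k, P k → k ≤ cs.length w := by
    rintro k ⟨v, -, hv⟩; omega
  obtain ⟨k, hk, hmax⟩ : ∃ k, P k ∧ ∀ k', P k' → k' ≤ k := by
    refine ⟨Nat.findGreatest P (cs.length w), Nat.findGreatest_spec (hbound 1 hP1) hP1, ?_⟩
    intro k' hk'
    exact Nat.le_findGreatest (hbound k' hk') hk'
  have hk1 : 1 ≤ k := hmax 1 hP1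
  obtain ⟨v, hv, hlen⟩ := hk
  -- neither `i` nor `j` is a right descent of `v`
  have hasc : ∀ q, (q = i ∨ q = j) → cs.length v < cs.length (v * cs.simple q) := by
    intro q hq
    by_contra hcon
    have hvq : cs.length (v * cs.simple q) + 1 = cs.length v := by
      rcases cs.length_mul_simple v q with h' | h' <;> omega
    -- Either q extends the alternating suffix, against maximality, or q is its first letter and
    -- cancels, against additivity of lengths.
    have hq' : q = (if Even k then j else i) ∨
        alternatingWord i j k = q :: alternatingWord i j (k - 1) := by
      obtain ⟨k, rfl⟩ : ∃ k', k = k' + 1 := ⟨k - 1, by omega⟩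
      rw [alternatingWord_succ']
      by_cases hk : Even k <;> simp [hk, Nat.even_add_one] <;> tauto
    rcases hq' with hq' | hq'
    · have : P (k + 1) := ⟨v * cs.simple q, by
        rw [alternatingWord_succ', wordProd_cons, ← hq', mul_assoc,
          simple_mul_simple_cancel_left, hv], by omega⟩
      have := hmax _ this
      omega
    · have h2 : w = v * cs.simple q * cs.wordProd (alternatingWord i j (k - 1)) := by
        rw [hv, hq', wordProd_cons, mul_assoc]
      have h3 := cs.length_mul_le (v * cs.simple q) (cs.wordProd (alternatingWord i j (k - 1)))
      have h4 := cs.length_wordProd_le (alternatingWord i j (k - 1))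
      rw [length_alternatingWord] at h4
      rw [← h2] at h3
      omega
  -- A suffix of length at least m could be rewritten by the braid relation to end in i, which would
  -- make i a right descent of w.
  have hkM : M i j ≠ 0 → k < M i j := by
    intro hM0
    by_contra hcon
    push Not at hcon
    obtain ⟨r, rfl⟩ : ∃ r, k = r + 1 := ⟨k - 1, by omega⟩
    -- rewrite the tail of length `M i j` by the braid relation
    have htail : ∃ u : W, cs.wordProd (alternatingWord i j (r + 1)) =
        u * cs.wordProd (alternatingWord i j (M i j)) ∧ cs.length u + M i j ≤ r + 1 := by
      have hgen : ∀ d, ∃ u : W, cs.wordProd (alternatingWord i j (M i j + d)) =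
          u * cs.wordProd (alternatingWord i j (M i j)) ∧ cs.length u ≤ d := by
        intro d
        induction d with
        | zero => exact ⟨1, by simp, by simp⟩
        | succ d ih =>
          obtain ⟨u, hu, hul⟩ := ih
          rw [← add_assoc, alternatingWord_succ', wordProd_cons, hu]
          refine ⟨_, (mul_assoc _ _ _).symm, ?_⟩
          refine (cs.length_mul_le _ _).trans ?_
          rw [length_simple]; omega
      obtain ⟨u, hu, hul⟩ := hgen (r + 1 - M i j)
      rw [Nat.add_sub_cancel' hcon] at hu
      exact ⟨u, hu, by omega⟩
    obtain ⟨u, hu, hul⟩ := htail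
    have hbraid := cs.wordProd_braidWord_eq i j
    unfold braidWord at hbraid
    rw [M.symmetric j i] at hbraid
    obtain ⟨m, hm⟩ : ∃ m, M i j = m + 1 := ⟨M i j - 1, by omega⟩
    have hws : w * cs.simple i = v * u * cs.wordProd (alternatingWord i j m) := by
      rw [hv, hu, hbraid, hm, alternatingWord_succ, wordProd_concat]
      simp [mul_assoc]
    have h3 := cs.length_mul_le (v * u) (cs.wordProd (alternatingWord i j m))
    have h4 := cs.length_wordProd_le (alternatingWord i j m)
    have h5 := cs.length_mul_le v u
    rw [length_alternatingWord] at h4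
    rw [← hws] at h3
    omega
  have hvi := IH (cs.length v) (by omega) (hasc i (Or.inl rfl)) rfl
  have hvj := IH (cs.length v) (by omega) (hasc j (Or.inr rfl)) rfl
  have c1 := M.dihedralCoeff_nonneg hij fun h => (hkM h).le
  have c2 := M.dihedralCoeff_nonneg hij (n := k + 1) fun h => hkM h
  rw [hv, geomRep_mul, geomRep_alternatingWord]
  split_ifs <;> rw [map_add, map_smul, map_smul] <;>
    exact add_nonneg (smul_nonneg (by assumption) hvi) (smul_nonneg (by assumption) hvj)

theorem geomRep_simpleRoot_nonpos {w : W} {i : B} (h : cs.length (w * cs.simple i) < cs.length w) :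
    cs.geomRep w (simpleRoot i) ≤ 0 := by
  have := cs.geomRep_simpleRoot_nonneg (w := w * cs.simple i) (i := i) (by simpa using h)
  rw [geomRep_mul, geomRep_simple_self, map_neg] at this
  exact neg_nonneg.1 this

/-! ### Roots and inversion sets -/

/-- The roots of a Coxeter system: the orbit of the simple roots. -/
def IsRoot (β : B →₀ ℝ) : Prop := ∃ (w : W) (i : B), β = cs.geomRep w (simpleRoot i)

/-- The positive roots sent to negative roots by `w⁻¹`. -/
def inversions (w : W) : Set (B →₀ ℝ) :=
  {β | cs.IsRoot β ∧ 0 ≤ β ∧ cs.geomRep w⁻¹ β ≤ 0}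

variable {cs}

theorem simpleRoot_nonneg (i : B) : 0 ≤ simpleRoot i := by simp

variable (cs) in
theorem isRoot_simpleRoot (i : B) : cs.IsRoot (simpleRoot i) := ⟨1, i, by simp⟩

theorem IsRoot.geomRep {β : B →₀ ℝ} (h : cs.IsRoot β) (w : W) : cs.IsRoot (cs.geomRep w β) := by
  obtain ⟨v, i, rfl⟩ := h
  exact ⟨w * v, i, (cs.geomRep_mul _ _ _).symm⟩

theorem IsRoot.neg {β : B →₀ ℝ} (h : cs.IsRoot β) : cs.IsRoot (-β) := by
  obtain ⟨v, i, rfl⟩ := h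
  exact ⟨v * cs.simple i, i, by rw [geomRep_mul, geomRep_simple_self, map_neg]⟩

theorem IsRoot.form_self {β : B →₀ ℝ} (h : cs.IsRoot β) : M.form β β = 2 := by
  obtain ⟨v, i, rfl⟩ := h
  rw [form_geomRep, M.form_simpleRoot_self]

theorem IsRoot.ne_zero {β : B →₀ ℝ} (h : cs.IsRoot β) : β ≠ 0 := by
  rintro rfl
  have := h.form_self
  simp at this

theorem IsRoot.nonneg_or_nonpos {β : B →₀ ℝ} (h : cs.IsRoot β) : 0 ≤ β ∨ β ≤ 0 := by
  obtain ⟨v, i, rfl⟩ := h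
  rcases lt_or_gt_of_ne (cs.length_mul_simple_ne v i) with h | h
  · exact Or.inr (cs.geomRep_simpleRoot_nonpos h)
  · exact Or.inl (cs.geomRep_simpleRoot_nonneg h)

theorem IsRoot.not_nonpos {β : B →₀ ℝ} (h : cs.IsRoot β) (h0 : 0 ≤ β) : ¬ β ≤ 0 :=
  fun h1 => h.ne_zero (le_antisymm h1 h0)

theorem geomRep_simple_apply_of_ne {i k : B} (h : k ≠ i) (x : B →₀ ℝ) :
    cs.geomRep (cs.simple i) x k = x k := by
  rw [geomRep_simple]
  simp [h.symm]

theorem IsRoot.eq_simpleRoot {β : B →₀ ℝ} (h : cs.IsRoot β) (h0 : 0 ≤ β) {i : B}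
    (hs : ∀ k, k ≠ i → β k = 0) : β = simpleRoot i := by
  classical
  have hβ : β = Finsupp.single i (β i) := by
    ext k
    by_cases hk : k = i
    · subst hk; simp
    · rw [hs k hk]; simp [Ne.symm hk]
  have h2 := h.form_self
  rw [hβ, M.form_single, M.pairing_self] at h2
  have h1 : 0 ≤ β i := h0 i
  have : β i = 1 := by nlinarith
  rw [hβ, this]

/-- The reflection changes only the i-th coordinate, so a positive root with another nonzero
coordinate stays positive. -/
theorem IsRoot.simple_nonneg {β : B →₀ ℝ} (h : cs.IsRoot β) (h0 : 0 ≤ β) {i : B}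
    (hi : β ≠ simpleRoot i) : 0 ≤ cs.geomRep (cs.simple i) β := by
  rcases (h.geomRep (cs.simple i)).nonneg_or_nonpos with h1 | h1
  · exact h1
  · refine absurd (h.eq_simpleRoot h0 fun k hk => ?_) hi
    have h2 : cs.geomRep (cs.simple i) β k ≤ 0 := h1 k
    rw [geomRep_simple_apply_of_ne hk] at h2
    exact le_antisymm h2 (h0 k)

theorem mem_inversions_iff_not_nonneg {β : B →₀ ℝ} (h : cs.IsRoot β) (h0 : 0 ≤ β) (w : W) :
    β ∈ cs.inversions w ↔ ¬ 0 ≤ cs.geomRep w⁻¹ β := by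
  constructor
  · exact fun hm h1 => (h.geomRep w⁻¹).not_nonpos h1 hm.2.2
  · exact fun hn => ⟨h, h0, ((h.geomRep w⁻¹).nonneg_or_nonpos).resolve_left hn⟩

@[simp] theorem inversions_one : cs.inversions 1 = ∅ := by
  ext β
  simp only [inversions, inv_one, geomRep_one, Set.mem_ofPred_eq, Set.mem_empty_iff_false,
    iff_false]
  exact fun ⟨h, h0, h1⟩ => h.not_nonpos h0 h1

theorem geomRep_simpleRoot_nonpos_iff {w : W} {i : B} :
    cs.geomRep w (simpleRoot i) ≤ 0 ↔ cs.IsRightDescent w i := by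
  constructor
  · intro h
    by_contra hc
    have := cs.not_isRightDescent_iff.1 hc
    exact ((cs.isRoot_simpleRoot i).geomRep w).not_nonpos
      (cs.geomRep_simpleRoot_nonneg (by omega)) h
  · exact fun h => cs.geomRep_simpleRoot_nonpos h

theorem simpleRoot_mem_inversions_iff {w : W} {i : B} :
    simpleRoot i ∈ cs.inversions w ↔ cs.IsLeftDescent w i := by
  rw [← isRightDescent_inv_iff, ← geomRep_simpleRoot_nonpos_iff]
  exact ⟨fun h => h.2.2, fun h => ⟨cs.isRoot_simpleRoot i, simpleRoot_nonneg i, h⟩⟩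

theorem mem_inversions_simple_mul_iff {β : B →₀ ℝ} (h : cs.IsRoot β) (h0 : 0 ≤ β) {i : B}
    (hi : β ≠ simpleRoot i) (w : W) :
    β ∈ cs.inversions (cs.simple i * w) ↔ cs.geomRep (cs.simple i) β ∈ cs.inversions w := by
  have h1 := h.simple_nonneg h0 hi
  have h2 := h.geomRep (cs.simple i)
  simp only [inversions, Set.mem_ofPred_eq, h, h0, h1, h2, mul_inv_rev, inv_simple, geomRep_mul,
    true_and]

theorem simpleRoot_mem_inversions_simple_mul_iff (i : B) (w : W) :
    simpleRoot i ∈ cs.inversions (cs.simple i * w) ↔ simpleRoot i ∉ cs.inversions w := by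
  rw [simpleRoot_mem_inversions_iff, simpleRoot_mem_inversions_iff,
    isLeftDescent_iff_not_isLeftDescent_mul, simple_mul_simple_cancel_left]

/-- Left multiplication by s moves inversions other than α_s by the reflection and toggles α_s;
hence only the status of α_s needs to match. -/
theorem inversions_simple_mul_subset {s : B} {v w : W}
    (hs : simpleRoot s ∈ cs.inversions v ↔ simpleRoot s ∈ cs.inversions w)
    (h : cs.inversions v ⊆ cs.inversions w) :
    cs.inversions (cs.simple s * v) ⊆ cs.inversions (cs.simple s * w) := by
  intro β hβ
  by_cases hne : β = simpleRoot s
  · subst hne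
    rw [simpleRoot_mem_inversions_simple_mul_iff] at hβ ⊢
    rwa [← hs]
  · exact (mem_inversions_simple_mul_iff hβ.1 hβ.2.1 hne w).2
      (h ((mem_inversions_simple_mul_iff hβ.1 hβ.2.1 hne v).1 hβ))

theorem IsRoot.simple_ne_simpleRoot {β : B →₀ ℝ} (h : cs.IsRoot β) (h0 : 0 ≤ β) (i : B) :
    cs.geomRep (cs.simple i) β ≠ simpleRoot i := by
  intro hc
  have : β = -simpleRoot i := by
    rw [← cs.geomRep_simple_simple i β, hc, geomRep_simple_self]
  exact h.not_nonpos h0 (by rw [this]; simp)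

theorem inversions_mul_simple {w : W} {i : B} (h : cs.length w < cs.length (w * cs.simple i)) :
    cs.inversions (w * cs.simple i) =
      insert (cs.geomRep w (simpleRoot i)) (cs.inversions w) := by
  have hp := cs.geomRep_simpleRoot_nonneg h
  ext β
  rw [Set.mem_insert_iff]
  by_cases hβ : cs.IsRoot β ∧ 0 ≤ β
  · obtain ⟨hr, h0⟩ := hβ
    by_cases he : β = cs.geomRep w (simpleRoot i)
    · simp only [he, true_or, iff_true]
      refine ⟨(cs.isRoot_simpleRoot i).geomRep w, hp, ?_⟩
      rw [mul_inv_rev, geomRep_mul, geomRep_inv_apply, inv_simple, geomRep_simple_self]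
      simp
    · have hr' := hr.geomRep w⁻¹
      simp only [he, false_or]
      rw [mem_inversions_iff_not_nonneg hr h0, mem_inversions_iff_not_nonneg hr h0, not_iff_not,
        mul_inv_rev, inv_simple, geomRep_mul]
      constructor
      · intro h1
        by_contra h2
        have h3 : 0 ≤ cs.geomRep w⁻¹ (-β) := by
          rw [map_neg]; exact neg_nonneg.2 (hr'.nonneg_or_nonpos.resolve_left h2)
        have h4 := (hr.neg.geomRep w⁻¹).simple_nonneg h3 (i := i) (by
          intro hc
          have : -β = cs.geomRep w (simpleRoot i) := by rw [← hc]; simp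
          exact hr.not_nonpos h0 (neg_nonneg.1 (this ▸ hp)))
        rw [map_neg, map_neg] at h4
        exact (hr'.geomRep (cs.simple i)).not_nonpos h1 (neg_nonneg.1 h4)
      · intro h1
        exact hr'.simple_nonneg h1 (by rintro hc; exact he (by rw [← hc]; simp))
  · constructor
    · exact fun hm => absurd ⟨hm.1, hm.2.1⟩ hβ
    · rintro (rfl | hm)
      · exact absurd ⟨(cs.isRoot_simpleRoot i).geomRep w, hp⟩ hβ
      · exact absurd ⟨hm.1, hm.2.1⟩ hβ

theorem inversions_closed {w : W} {β γ : B →₀ ℝ} (hβ : β ∈ cs.inversions w)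
    (hγ : γ ∈ cs.inversions w) {x y : ℝ} (hx : 0 ≤ x) (hy : 0 ≤ y)
    (hr : cs.IsRoot (x • β + y • γ)) : x • β + y • γ ∈ cs.inversions w := by
  refine ⟨hr, add_nonneg (smul_nonneg hx hβ.2.1) (smul_nonneg hy hγ.2.1), ?_⟩
  rw [map_add, map_smul, map_smul]
  exact add_nonpos (smul_nonpos_of_nonneg_of_nonpos hx hβ.2.2)
    (smul_nonpos_of_nonneg_of_nonpos hy hγ.2.2)

/-! ### The weak order -/

theorem WeakLE.inversions_subset {v w : W} (h : cs.WeakLE v w) :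
    cs.inversions v ⊆ cs.inversions w := by
  induction h with
  | refl => exact subset_rfl
  | tail _ h ih =>
    obtain ⟨i, rfl, hl⟩ := h
    rw [inversions_mul_simple hl]
    exact ih.trans (Set.subset_insert _ _)

/-- A step up from `v` towards `w`. -/
theorem exists_simple_of_inversions_subset {v w : W}
    (h : cs.inversions v ⊆ cs.inversions w) (hne : v ≠ w) :
    ∃ i, cs.length v < cs.length (v * cs.simple i) ∧
      cs.inversions (v * cs.simple i) ⊆ cs.inversions w ∧
      cs.length ((v * cs.simple i)⁻¹ * w) < cs.length (v⁻¹ * w) := by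
  -- A right descent i of w⁻¹v makes w⁻¹(vα_i) negative. Were vα_i negative as well, its opposite
  -- would be an inversion of v but not of w.
  have h1 : w⁻¹ * v ≠ 1 := fun hc => hne (by rw [inv_mul_eq_one] at hc; exact hc.symm)
  obtain ⟨i, hi⟩ := cs.exists_rightDescent_of_ne_one h1
  have hneg := geomRep_simpleRoot_nonpos_iff.2 hi
  rw [geomRep_mul] at hneg
  have hr := (cs.isRoot_simpleRoot i).geomRep v
  have hpos : 0 ≤ cs.geomRep v (simpleRoot i) := by
    by_contra hc
    have h2 : 0 ≤ -cs.geomRep v (simpleRoot i) :=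
      neg_nonneg.2 (hr.nonneg_or_nonpos.resolve_left hc)
    have h3 : -cs.geomRep v (simpleRoot i) ∈ cs.inversions v :=
      ⟨hr.neg, h2, by rw [map_neg, geomRep_inv_apply]; simp⟩
    have h4 := (h h3).2.2
    rw [map_neg] at h4
    exact (hr.geomRep w⁻¹).not_nonpos (by simpa using h4) hneg
  have hlt : cs.length v < cs.length (v * cs.simple i) := by
    by_contra hc
    have : cs.IsRightDescent v i :=
      lt_of_le_of_ne (not_lt.1 hc) (cs.length_mul_simple_ne v i)
    exact hr.not_nonpos hpos (geomRep_simpleRoot_nonpos_iff.2 this)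
  refine ⟨i, hlt, ?_, ?_⟩
  · rw [inversions_mul_simple hlt]
    exact Set.insert_subset ⟨hr, hpos, hneg⟩ h
  · have e1 : (v * cs.simple i)⁻¹ * w = (w⁻¹ * v * cs.simple i)⁻¹ := by simp [mul_assoc]
    have e2 : v⁻¹ * w = (w⁻¹ * v)⁻¹ := by simp
    rw [e1, e2, length_inv, length_inv]
    exact hi

theorem weakLE_iff_inversions_subset {v w : W} :
    cs.WeakLE v w ↔ cs.inversions v ⊆ cs.inversions w := by
  refine ⟨WeakLE.inversions_subset, fun h => ?_⟩
  induction hN : cs.length (v⁻¹ * w) using Nat.strong_induction_on generalizing v with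
  | _ N IH =>
  by_cases hne : v = w
  · subst hne; exact Relation.ReflTransGen.refl
  obtain ⟨i, h1, h2, h3⟩ := exists_simple_of_inversions_subset h hne
  exact Relation.ReflTransGen.head ⟨i, rfl, h1⟩ (IH _ (by omega) h2 rfl)

theorem WeakLE.length_le {v w : W} (h : cs.WeakLE v w) : cs.length v ≤ cs.length w := by
  induction h with
  | refl => exact le_rfl
  | tail _ h ih =>
    obtain ⟨i, rfl, hl⟩ := h
    omega

theorem WeakLE.eq_of_length_le {v w : W} (h : cs.WeakLE v w)
    (hl : cs.length w ≤ cs.length v) : v = w := by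
  rcases Relation.ReflTransGen.cases_head h with h | ⟨u, ⟨i, rfl, h1⟩, h2⟩
  · exact h
  · have := WeakLE.length_le h2
    omega

theorem inversions_injective : Function.Injective cs.inversions := by
  intro v w h
  exact (weakLE_iff_inversions_subset.2 h.subset).eq_of_length_le
    (weakLE_iff_inversions_subset.2 h.superset).length_le

theorem neg_geomRep_mem_inversions {w : W} {i : B} (h : cs.IsRightDescent w i) :
    -cs.geomRep w (simpleRoot i) ∈ cs.inversions w :=
  ⟨((cs.isRoot_simpleRoot i).geomRep w).neg, neg_nonneg.2 (geomRep_simpleRoot_nonpos_iff.2 h),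
    by rw [map_neg, geomRep_inv_apply]; simp⟩

/-- Removing a right descent removes exactly one inversion. -/
theorem mem_inversions_mul_simple_iff {w : W} {i : B} (h : cs.IsRightDescent w i)
    {β : B →₀ ℝ} : β ∈ cs.inversions (w * cs.simple i) ↔
      β ∈ cs.inversions w ∧ β ≠ -cs.geomRep w (simpleRoot i) := by
  have h1 : cs.length (w * cs.simple i) < cs.length (w * cs.simple i * cs.simple i) := by
    simpa [IsRightDescent] using h
  have h2 := inversions_mul_simple h1
  rw [simple_mul_simple_cancel_right, geomRep_mul, geomRep_simple_self, map_neg] at h2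
  rw [h2, Set.mem_insert_iff]
  constructor
  · intro hm
    refine ⟨Or.inr hm, ?_⟩
    rintro rfl
    have := hm.2.2
    rw [map_neg, mul_inv_rev, geomRep_mul, geomRep_inv_apply, inv_simple, geomRep_simple_self,
      neg_neg] at this
    exact (cs.isRoot_simpleRoot i).not_nonpos (simpleRoot_nonneg i) this
  · rintro ⟨hm | hm, hne⟩
    · exact absurd hm hne
    · exact hm

/-- A minimal element among those below `w` with an upward closed property given by a set of
inversions: all of its cover roots lie in the given set. -/
theorem exists_minimal_upper_bound {w : W} {N : Set (B →₀ ℝ)} (hN : N ⊆ cs.inversions w) :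
    ∃ x, cs.inversions x ⊆ cs.inversions w ∧ N ⊆ cs.inversions x ∧
      ∀ i, cs.IsRightDescent x i → -cs.geomRep x (simpleRoot i) ∈ N := by
  induction hl : cs.length w using Nat.strong_induction_on generalizing w with
  | _ l IH =>
  by_cases hc : ∀ i, cs.IsRightDescent w i → -cs.geomRep w (simpleRoot i) ∈ N
  · exact ⟨w, subset_rfl, hN, hc⟩
  · push Not at hc
    obtain ⟨i, hi, hi'⟩ := hc
    have hsub : cs.inversions (w * cs.simple i) ⊆ cs.inversions w := fun β hβ =>
      ((mem_inversions_mul_simple_iff hi).1 hβ).1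
    obtain ⟨x, h1, h2, h3⟩ := IH (cs.length (w * cs.simple i)) (by
        have : cs.length (w * cs.simple i) < cs.length w := hi
        omega) (w := w * cs.simple i)
      (fun β hβ => (mem_inversions_mul_simple_iff hi).2
        ⟨hN hβ, fun hc => hi' (hc ▸ hβ)⟩) rfl
    exact ⟨x, h1.trans hsub, h2, h3⟩

theorem eq_one_of_inversions_eq_empty {w : W} (h : cs.inversions w = ∅) : w = 1 :=
  inversions_injective (by rw [h, inversions_one])

/-! ### Standard parabolic subgroups -/

theorem simple_mem_parabolic {J : Set B} {i : B} (h : i ∈ J) :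
    cs.simple i ∈ cs.parabolic J :=
  Subgroup.subset_closure ⟨i, h, rfl⟩

theorem parabolic_mono {J K : Set B} (h : J ⊆ K) : cs.parabolic J ≤ cs.parabolic K :=
  Subgroup.closure_mono (Set.image_mono h)

theorem geomRep_apply_of_mem_parabolic {J : Set B} {w : W} (hw : w ∈ cs.parabolic J) {k : B}
    (hk : k ∉ J) (x : B →₀ ℝ) : cs.geomRep w x k = x k := by
  induction hw using Subgroup.closure_induction generalizing x with
  | mem y hy =>
    obtain ⟨i, hi, rfl⟩ := hy
    exact geomRep_simple_apply_of_ne (by rintro rfl; exact hk hi) x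
  | one => simp
  | mul y z _ _ hy hz => rw [geomRep_mul, hy, hz]
  | inv y _ hy => rw [← hy (cs.geomRep y⁻¹ x), geomRep_apply_inv]

theorem apply_eq_zero_of_mem_inversions {J : Set B} {w : W} (hw : w ∈ cs.parabolic J)
    {β : B →₀ ℝ} (hβ : β ∈ cs.inversions w) {k : B} (hk : k ∉ J) : β k = 0 := by
  have h1 : cs.geomRep w⁻¹ β k ≤ 0 := hβ.2.2 k
  rw [geomRep_apply_of_mem_parabolic (inv_mem hw) hk] at h1
  exact le_antisymm h1 (hβ.2.1 k)

variable (cs) in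
theorem exists_parabolic_factorization (J : Set B) (w : W) :
    ∃ u ∈ cs.parabolic J, ∃ z, w = u * z ∧
      ∀ i ∈ J, cs.length z < cs.length (cs.simple i * z) := by
  induction hl : cs.length w using Nat.strong_induction_on generalizing w with
  | _ l IH =>
  by_cases hc : ∀ i ∈ J, cs.length w < cs.length (cs.simple i * w)
  · exact ⟨1, one_mem _, w, by simp, hc⟩
  · push Not at hc
    obtain ⟨i, hi, hi'⟩ := hc
    obtain ⟨u, hu, z, hz, hz'⟩ := IH (cs.length (cs.simple i * w)) (by
      have := cs.length_simple_mul_ne w i; omega) (cs.simple i * w) rfl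
    exact ⟨cs.simple i * u, mul_mem (simple_mem_parabolic hi) hu, z, by
      rw [mul_assoc, ← hz, simple_mul_simple_cancel_left], hz'⟩

/-- A nonnegative vector supported on J is a nonnegative combination of the simple roots in J, and
none of these is made negative by z⁻¹. -/
theorem geomRep_inv_nonneg_of_supported {J : Set B} {z : W}
    (hz : ∀ i ∈ J, cs.length z < cs.length (cs.simple i * z)) {x : B →₀ ℝ} (h0 : 0 ≤ x)
    (hx : ∀ k ∉ J, x k = 0) : 0 ≤ cs.geomRep z⁻¹ x := by
  rw [← Finsupp.sum_single x, map_finsuppSum]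
  refine Finset.sum_nonneg fun i hi => ?_
  have hiJ : i ∈ J := by
    by_contra hc
    exact (Finsupp.mem_support_iff.1 hi) (hx i hc)
  have : Finsupp.single i (x i) = x i • simpleRoot i := by simp
  change 0 ≤ cs.geomRep z⁻¹ (Finsupp.single i (x i))
  rw [this, map_smul]
  refine smul_nonneg (h0 i) (cs.geomRep_simpleRoot_nonneg ?_)
  have e : z⁻¹ * cs.simple i = (cs.simple i * z)⁻¹ := by simp
  rw [e, length_inv, length_inv]
  exact hz i hiJ

theorem mem_inversions_parabolic_part_iff {J : Set B} {u z : W} (hu : u ∈ cs.parabolic J)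
    (hz : ∀ i ∈ J, cs.length z < cs.length (cs.simple i * z)) {β : B →₀ ℝ} :
    β ∈ cs.inversions u ↔ β ∈ cs.inversions (u * z) ∧ ∀ k ∉ J, β k = 0 := by
  constructor
  · intro hβ
    have hs := fun k (hk : k ∉ J) => apply_eq_zero_of_mem_inversions hu hβ hk
    refine ⟨⟨hβ.1, hβ.2.1, ?_⟩, hs⟩
    rw [mul_inv_rev, geomRep_mul]
    have := geomRep_inv_nonneg_of_supported hz (x := -cs.geomRep u⁻¹ β) (neg_nonneg.2 hβ.2.2)
      (fun k hk => by
        rw [Finsupp.neg_apply, geomRep_apply_of_mem_parabolic (inv_mem hu) hk, hs k hk, neg_zero])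
    rw [map_neg] at this
    exact neg_nonneg.1 this
  · rintro ⟨hβ, hs⟩
    rw [mem_inversions_iff_not_nonneg hβ.1 hβ.2.1]
    intro hc
    have := geomRep_inv_nonneg_of_supported hz hc (fun k hk => by
        rw [geomRep_apply_of_mem_parabolic (inv_mem hu) hk, hs k hk])
    rw [← geomRep_mul, ← mul_inv_rev] at this
    exact (hβ.1.geomRep _).not_nonpos this hβ.2.2

theorem IsParabolicPart.mem_inversions_iff {J : Set B} {w u : W} (h : cs.IsParabolicPart J w u)
    {β : B →₀ ℝ} : β ∈ cs.inversions u ↔ β ∈ cs.inversions w ∧ ∀ k ∉ J, β k = 0 := by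
  obtain ⟨hu, z, rfl, hz⟩ := h
  exact mem_inversions_parabolic_part_iff hu hz

/-- An element all of whose cover roots are supported on `J` lies in the parabolic subgroup. -/
theorem mem_parabolic_of_cover_roots {J : Set B} {w : W}
    (h : ∀ i, cs.IsRightDescent w i → ∀ k ∉ J, cs.geomRep w (simpleRoot i) k = 0) :
    w ∈ cs.parabolic J := by
  obtain ⟨u, hu, z, rfl, hz⟩ := cs.exists_parabolic_factorization J w
  by_cases hz1 : z = 1
  · simpa [hz1] using hu
  exfalso
  -- For a right descent i of z, the inversion −zα_i has a nonzero coordinate outside J, since z⁻¹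
  -- keeps nonnegative J-supported vectors nonnegative. As u does not touch that coordinate, i is a
  -- descent of uz whose cover root leaves J.
  obtain ⟨i, hi⟩ := cs.exists_rightDescent_of_ne_one hz1
  have hm := neg_geomRep_mem_inversions hi
  obtain ⟨k, hk, hk'⟩ : ∃ k ∉ J, (-cs.geomRep z (simpleRoot i)) k ≠ 0 := by
    by_contra hc
    push Not at hc
    exact (hm.1.geomRep z⁻¹).not_nonpos (geomRep_inv_nonneg_of_supported hz hm.2.1 hc) hm.2.2
  have hpos : 0 < (-cs.geomRep z (simpleRoot i)) k :=
    lt_of_le_of_ne (hm.2.1 k) (Ne.symm hk')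
  have hneg : cs.geomRep (u * z) (simpleRoot i) k < 0 := by
    rw [geomRep_mul, geomRep_apply_of_mem_parabolic hu hk]
    simpa using hpos
  have hdes : cs.IsRightDescent (u * z) i := by
    rw [← geomRep_simpleRoot_nonpos_iff]
    refine (((cs.isRoot_simpleRoot i).geomRep (u * z)).nonneg_or_nonpos).resolve_left fun h0 => ?_
    exact absurd (h0 k) (not_le.2 hneg)
  exact hneg.ne (h i hdes k hk)

theorem mem_parabolic_iff {J : Set B} {w : W} :
    w ∈ cs.parabolic J ↔ ∀ β ∈ cs.inversions w, ∀ k ∉ J, β k = 0 := by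
  constructor
  · exact fun hw β hβ k hk => apply_eq_zero_of_mem_inversions hw hβ hk
  · intro h
    refine mem_parabolic_of_cover_roots fun i hi k hk => ?_
    simpa using h _ (neg_geomRep_mem_inversions hi) k hk

/-- The geometric representation is faithful. -/
theorem geomRep_injective {v w : W} (h : ∀ x, cs.geomRep v x = cs.geomRep w x) : v = w := by
  refine inversions_injective (cs := cs) (Set.ext fun β => ?_)
  have : cs.geomRep v⁻¹ β = cs.geomRep w⁻¹ β := by
    calc cs.geomRep v⁻¹ β = cs.geomRep v⁻¹ (cs.geomRep w (cs.geomRep w⁻¹ β)) := by simp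
      _ = _ := by rw [← h, geomRep_inv_apply]
  simp [inversions, this]

theorem simple_mul_eq_mul_simple {w : W} {i j : B}
    (h : cs.geomRep w (simpleRoot i) = -simpleRoot j) : cs.simple j * w = w * cs.simple i := by
  refine geomRep_injective (cs := cs) fun x => ?_
  rw [geomRep_mul, geomRep_mul, geomRep_simple, geomRep_simple, map_sub, map_smul, h,
    ← cs.form_geomRep w (simpleRoot i), h]
  simp

end CoxeterSystem

/-! ### The Euler form of a word -/

namespace CoxeterMatrix

variable {B : Type*} (M : CoxeterMatrix B)

/-- The Euler form of a word `a` without repeated letters: the (non-symmetric) bilinear form on the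
span of the simple roots in `a` whose symmetrization is `M.form`, for which each simple root pairs
to zero with the later ones. -/
noncomputable def eulerForm : List B → (B →₀ ℝ) → (B →₀ ℝ) → ℝ
  | [], _, _ => 0
  | s :: d, x, y => (x s + (d.map fun r => x r * M.pairing r s).sum) * y s + eulerForm d x y

/-- The antisymmetrization of the Euler form. -/
noncomputable def omega (a : List B) (x y : B →₀ ℝ) : ℝ :=
  M.eulerForm a x y - M.eulerForm a y x

variable {M}

theorem eulerForm_congr {a : List B} {x x' y y' : B →₀ ℝ} (hx : ∀ k ∈ a, x k = x' k)
    (hy : ∀ k ∈ a, y k = y' k) : M.eulerForm a x y = M.eulerForm a x' y' := by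
  induction a with
  | nil => rfl
  | cons s d ih =>
    have h1 : d.map (fun r => x r * M.pairing r s) = d.map fun r => x' r * M.pairing r s :=
      List.map_congr_left fun r hr => by rw [hx r (by simp [hr])]
    rw [eulerForm, eulerForm, h1, hx s (by simp), hy s (by simp),
      ih (fun k hk => hx k (by simp [hk])) fun k hk => hy k (by simp [hk])]

theorem eulerForm_add_left (a : List B) (x x' y : B →₀ ℝ) :
    M.eulerForm a (x + x') y = M.eulerForm a x y + M.eulerForm a x' y := by
  induction a with
  | nil => simp [eulerForm]
  | cons s d ih =>
    simp only [eulerForm, ih, Finsupp.add_apply, add_mul, List.sum_map_add]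
    ring

theorem eulerForm_smul_left (a : List B) (c : ℝ) (x y : B →₀ ℝ) :
    M.eulerForm a (c • x) y = c * M.eulerForm a x y := by
  induction a with
  | nil => simp [eulerForm]
  | cons s d ih =>
    simp only [eulerForm, ih, Finsupp.smul_apply, smul_eq_mul, mul_assoc, List.sum_map_mul_left]
    ring

theorem eulerForm_zero_left (a : List B) (y : B →₀ ℝ) : M.eulerForm a 0 y = 0 := by
  have := M.eulerForm_smul_left a 0 0 y
  simpa using this

theorem eulerForm_zero_right (a : List B) (x : B →₀ ℝ) : M.eulerForm a x 0 = 0 := by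
  induction a with
  | nil => rfl
  | cons s d ih => simp [eulerForm, ih]

theorem eulerForm_append_singleton (d : List B) (s : B) (x y : B →₀ ℝ) :
    M.eulerForm (d ++ [s]) x y =
      x s * (y s + (d.map fun r => y r * M.pairing r s).sum) + M.eulerForm d x y := by
  induction d with
  | nil => simp [eulerForm]
  | cons q d ih =>
    rw [List.cons_append, eulerForm, ih, eulerForm]
    simp only [List.map_append, List.sum_append, List.map_cons, List.map_nil, List.sum_cons,
      List.sum_nil, M.pairing_comm s q]
    ring

theorem eulerForm_simpleRoot_left {s : B} {d : List B} (hs : s ∉ d) (y : B →₀ ℝ) :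
    M.eulerForm (s :: d) (simpleRoot s) y = y s := by
  have h1 : M.eulerForm d (simpleRoot s) y = M.eulerForm d 0 y :=
    eulerForm_congr (fun k hk => by
      have : s ≠ k := by rintro rfl; exact hs hk
      simp [this]) fun _ _ => rfl
  have h2 : (d.map fun r => simpleRoot s r * M.pairing r s).sum = 0 := by
    refine List.sum_eq_zero fun t ht => ?_
    obtain ⟨r, hr, rfl⟩ := List.mem_map.1 ht
    have : s ≠ r := by rintro rfl; exact hs hr
    simp [this]
  rw [eulerForm, h1, h2, eulerForm_zero_left]
  simp

theorem eulerForm_simpleRoot_right {s : B} {d : List B} (hs : s ∉ d) (y : B →₀ ℝ) :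
    M.eulerForm (s :: d) y (simpleRoot s) =
      y s + (d.map fun r => y r * M.pairing r s).sum := by
  have h1 : M.eulerForm d y (simpleRoot s) = M.eulerForm d y 0 :=
    eulerForm_congr (fun _ _ => rfl) (fun k hk => by
      have : s ≠ k := by rintro rfl; exact hs hk
      simp [this])
  rw [eulerForm, h1, eulerForm_zero_right]
  simp

theorem form_simpleRoot_eq_sum {a : List B} (ha : a.Nodup) {x : B →₀ ℝ}
    (hx : ∀ k ∉ a, x k = 0) (s : B) :
    M.form (simpleRoot s) x = (a.map fun r => x r * M.pairing r s).sum := by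
  classical
  have h1 : x.support ⊆ a.toFinset := fun k hk => by
    rw [List.mem_toFinset]
    by_contra hc
    exact Finsupp.mem_support_iff.1 hk (hx k hc)
  have h2 : M.form (simpleRoot s) x = x.sum fun j b => b * M.pairing j s := by
    simp [form, Finsupp.linearCombination_apply, M.pairing_comm s]
  rw [h2, Finsupp.sum_of_support_subset _ h1 _ (by simp), ← List.sum_toFinset _ ha]

/-- The diagonal value 2 splits as 1 + 1, while for distinct letters each cross term of the form
occurs in exactly one of the two Euler forms. -/
theorem eulerForm_add_swap {a : List B} (ha : a.Nodup) {x y : B →₀ ℝ}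
    (hx : ∀ k ∉ a, x k = 0) (hy : ∀ k ∉ a, y k = 0) :
    M.eulerForm a x y + M.eulerForm a y x = M.form x y := by
  induction a generalizing x y with
  | nil =>
    have : x = 0 := Finsupp.ext fun k => hx k (by simp)
    simp [eulerForm, this]
  | cons s d ih =>
    obtain ⟨hs, hd⟩ := List.nodup_cons.1 ha
    have key : ∀ z : B →₀ ℝ, (∀ k ∉ s :: d, z k = 0) → ∃ z' : B →₀ ℝ,
        z = z s • simpleRoot s + z' ∧ (∀ k ∉ d, z' k = 0) ∧ ∀ k ∈ d, z k = z' k := by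
      intro z hz
      refine ⟨z - z s • simpleRoot s, by module, fun k hk => ?_, fun k hk => ?_⟩
      · by_cases hks : k = s
        · subst hks; simp
        · simp [Ne.symm hks, hz k (by simp [hk, hks])]
      · have : s ≠ k := by rintro rfl; exact hs hk
        simp [this]
    obtain ⟨x', hx1, hx2, hx3⟩ := key x hx
    obtain ⟨y', hy1, hy2, hy3⟩ := key y hy
    have e1 : M.form x y = 2 * (x s * y s) + x s * M.form (simpleRoot s) y' +
        y s * M.form (simpleRoot s) x' + M.form x' y' := by
      conv_lhs => rw [hx1, hy1]
      simp only [map_add, map_smul, LinearMap.add_apply, LinearMap.smul_apply, smul_eq_mul,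
        M.form_simpleRoot_self, M.form_comm x' (simpleRoot s)]
      ring
    have e2 : ∀ z z' : B →₀ ℝ, (∀ k ∈ d, z k = z' k) →
        d.map (fun r => z r * M.pairing r s) = d.map fun r => z' r * M.pairing r s :=
      fun z z' h => List.map_congr_left fun r hr => by rw [h r hr]
    rw [e1, form_simpleRoot_eq_sum hd hx2, form_simpleRoot_eq_sum hd hy2, ← ih hd hx2 hy2,
      eulerForm, eulerForm, e2 x x' hx3, e2 y y' hy3, eulerForm_congr hx3 hy3,
      eulerForm_congr hy3 hx3]
    ring

theorem simpleReflection_apply_self {s : B} {d : List B} (hn : (s :: d).Nodup) {x : B →₀ ℝ}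
    (hx : ∀ k ∉ s :: d, x k = 0) : (x - M.form (simpleRoot s) x • simpleRoot s) s =
      -x s - (d.map fun r => x r * M.pairing r s).sum := by
  rw [form_simpleRoot_eq_sum hn hx]
  simp [M.pairing_self]
  ring

theorem sum_mul_pairing_nonpos {s : B} {d : List B} (hs : s ∉ d) {y : B →₀ ℝ}
    (hy : 0 ≤ y) : (d.map fun r => y r * M.pairing r s).sum ≤ 0 := by
  induction d with
  | nil => simp
  | cons q d ih =>
    simp only [List.mem_cons, not_or] at hs
    rw [List.map_cons, List.sum_cons]
    exact add_nonpos (mul_nonpos_of_nonneg_of_nonpos (hy q) (M.pairing_nonpos (Ne.symm hs.1)))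
      (ih hs.2)

/-- Off-diagonal pairings are nonpositive, so the first letter precedes everything in the
orientation. Dually the last letter comes after everything. -/
theorem omega_simpleRoot_left_nonneg {s : B} {d : List B} (hs : s ∉ d) {y : B →₀ ℝ}
    (hy : 0 ≤ y) : 0 ≤ M.omega (s :: d) (simpleRoot s) y := by
  rw [omega, eulerForm_simpleRoot_left hs, eulerForm_simpleRoot_right hs]
  have : (d.map fun r => y r * M.pairing r s).sum ≤ 0 :=
    sum_mul_pairing_nonpos hs hy
  linarith

theorem omega_append_simpleRoot_left_nonpos {s : B} {d : List B} (hs : s ∉ d) {y : B →₀ ℝ}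
    (hy : 0 ≤ y) : M.omega (d ++ [s]) (simpleRoot s) y ≤ 0 := by
  have h0 : ∀ k ∈ d, simpleRoot s k = (0 : B →₀ ℝ) k := fun k hk => by
    have : s ≠ k := by rintro rfl; exact hs hk
    simp [this]
  have h1 : (d.map fun r => y r * M.pairing r s).sum ≤ 0 :=
    sum_mul_pairing_nonpos hs hy
  have h2 : (d.map fun r => simpleRoot s r * M.pairing r s).sum = 0 := by
    refine List.sum_eq_zero fun t ht => ?_
    obtain ⟨r, hr, rfl⟩ := List.mem_map.1 ht
    rw [h0 r hr]; simp
  rw [omega, eulerForm_append_singleton, eulerForm_append_singleton, h2,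
    eulerForm_congr h0 (fun _ _ => rfl : ∀ k ∈ d, y k = y k),
    eulerForm_congr (fun _ _ => rfl : ∀ k ∈ d, y k = y k) h0, eulerForm_zero_left,
    eulerForm_zero_right]
  simp
  linarith

theorem omega_simpleRoot_right_nonpos {s : B} {d : List B} (hs : s ∉ d) {y : B →₀ ℝ}
    (hy : 0 ≤ y) : M.omega (s :: d) y (simpleRoot s) ≤ 0 := by
  have := omega_simpleRoot_left_nonneg (M := M) hs hy
  unfold omega at *
  linarith

theorem eulerForm_cons_of_apply_eq_zero {s : B} (d : List B) {x y : B →₀ ℝ}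
    (hy : y s = 0) : M.eulerForm (s :: d) x y = M.eulerForm d x y := by
  rw [eulerForm, hy, mul_zero, zero_add]

theorem omega_cons_of_apply_eq_zero {s : B} (d : List B) {x y : B →₀ ℝ}
    (hx : x s = 0) (hy : y s = 0) : M.omega (s :: d) x y = M.omega d x y := by
  rw [omega, omega, eulerForm_cons_of_apply_eq_zero d hx, eulerForm_cons_of_apply_eq_zero d hy]

theorem omega_append_of_apply_eq_zero {s : B} (d : List B) {x y : B →₀ ℝ}
    (hx : x s = 0) (hy : y s = 0) : M.omega (d ++ [s]) x y = M.omega d x y := by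
  rw [omega, omega, eulerForm_append_singleton, eulerForm_append_singleton, hx, hy]
  ring

theorem omega_cons_cons_of_apply_eq_zero {s r : B} (d : List B) {x y : B →₀ ℝ}
    (hx : x r = 0) (hy : y r = 0) : M.omega (s :: r :: d) x y = M.omega (s :: d) x y := by
  simp [omega, eulerForm, hx, hy]

end CoxeterMatrix

/-! ### Aligned elements and rotation of the word -/

namespace CoxeterSystem

open CoxeterMatrix (simpleRoot)

variable {B W : Type*} [Group W] {M : CoxeterMatrix B} {cs : CoxeterSystem M W}

/-- Only the s-coordinate changes, to x'_s = −x_s − Σ x_r⟨r, s⟩. The first-letter term is then −x'_s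
y_s, which is the last-letter term of the rotated word because y'_s + Σ y_r⟨r, s⟩ = −y_s. -/
theorem eulerForm_rotate {s : B} {d : List B} (hn : (s :: d).Nodup) {x y : B →₀ ℝ}
    (hx : ∀ k ∉ s :: d, x k = 0) (hy : ∀ k ∉ s :: d, y k = 0) :
    M.eulerForm (d ++ [s]) (cs.geomRep (cs.simple s) x) (cs.geomRep (cs.simple s) y) =
      M.eulerForm (s :: d) x y := by
  obtain ⟨hs, hd⟩ := List.nodup_cons.1 hn
  have hne : ∀ k ∈ d, k ≠ s := by rintro k hk rfl; exact hs hk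
  have hmap : d.map (fun r => cs.geomRep (cs.simple s) y r * M.pairing r s) =
      d.map fun r => y r * M.pairing r s :=
    List.map_congr_left fun r hr => by rw [geomRep_simple_apply_of_ne (hne r hr)]
  rw [CoxeterMatrix.eulerForm_append_singleton, hmap, geomRep_simple, geomRep_simple,
    CoxeterMatrix.simpleReflection_apply_self hn hx,
    CoxeterMatrix.simpleReflection_apply_self hn hy, ← cs.geomRep_simple, ← cs.geomRep_simple,
    CoxeterMatrix.eulerForm_congr (x' := x) (y' := y)
      (fun k hk => geomRep_simple_apply_of_ne (hne k hk) x)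
      (fun k hk => geomRep_simple_apply_of_ne (hne k hk) y), CoxeterMatrix.eulerForm]
  ring

theorem omega_rotate {s : B} {d : List B} (hn : (s :: d).Nodup) {x y : B →₀ ℝ}
    (hx : ∀ k ∉ s :: d, x k = 0) (hy : ∀ k ∉ s :: d, y k = 0) :
    M.omega (d ++ [s]) (cs.geomRep (cs.simple s) x) (cs.geomRep (cs.simple s) y) =
      M.omega (s :: d) x y := by
  rw [CoxeterMatrix.omega, CoxeterMatrix.omega, eulerForm_rotate hn hx hy,
    eulerForm_rotate hn hy hx]

variable (cs) in
/-- `w` lies in the parabolic subgroup generated by the letters of `a`, and its inversion set is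
compatible with the orientation given by `a` of the rank two root subsystems. -/
structure Aligned (a : List B) (w : W) : Prop where
  supported : ∀ β ∈ cs.inversions w, ∀ k ∉ a, β k = 0
  mem_of_omega_pos : ∀ β γ, cs.IsRoot β → 0 ≤ β → cs.IsRoot γ → 0 ≤ γ → ∀ x y : ℝ, 0 < x → 0 < y →
    x • β + y • γ ∈ cs.inversions w → 0 < M.omega a β γ → β ∈ cs.inversions w

theorem apply_eq_zero_of_add {β γ : B →₀ ℝ} (hβ : 0 ≤ β) (hγ : 0 ≤ γ) {x y : ℝ} (hx : 0 < x)
    (hy : 0 < y) {k : B} (h : (x • β + y • γ) k = 0) : β k = 0 ∧ γ k = 0 := by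
  have h1 : 0 ≤ β k := hβ k
  have h2 : 0 ≤ γ k := hγ k
  simp only [Finsupp.add_apply, Finsupp.smul_apply, smul_eq_mul] at h
  have h3 := mul_nonneg hx.le h1
  have h4 := mul_nonneg hy.le h2
  constructor
  · exact (mul_eq_zero.1 (by linarith : x * β k = 0)).resolve_left hx.ne'
  · exact (mul_eq_zero.1 (by linarith : y * γ k = 0)).resolve_left hy.ne'

theorem IsRoot.eq_simpleRoot_of_add {β γ : B →₀ ℝ} (hr : cs.IsRoot β) (hβ : 0 ≤ β) (hγ : 0 ≤ γ)
    {x y : ℝ} (hx : 0 < x) (hy : 0 < y) {s : B} (h : x • β + y • γ = simpleRoot s) :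
    β = simpleRoot s :=
  hr.eq_simpleRoot hβ fun k hk =>
    (apply_eq_zero_of_add hβ hγ hx hy (k := k) (by rw [h]; simp [Ne.symm hk])).1

theorem Aligned.of_supported {a b : List B} {w : W} (h : cs.Aligned a w) (K : Set B)
    (hK : ∀ β ∈ cs.inversions w, ∀ k ∉ K, β k = 0) (hb : ∀ k ∈ K, k ∈ b)
    (hω : ∀ β γ : B →₀ ℝ, (∀ k ∉ K, β k = 0) → (∀ k ∉ K, γ k = 0) →
      M.omega a β γ = M.omega b β γ) : cs.Aligned b w where
  supported β hβ k hk := hK β hβ k fun hc => hk (hb k hc)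
  mem_of_omega_pos β γ hβ hβ0 hγ hγ0 x y hx hy hm ho := by
    have hsupp := fun k (hk : k ∉ K) => apply_eq_zero_of_add hβ0 hγ0 hx hy (hK _ hm k hk)
    refine h.mem_of_omega_pos β γ hβ hβ0 hγ hγ0 x y hx hy hm ?_
    rwa [hω β γ (fun k hk => (hsupp k hk).1) fun k hk => (hsupp k hk).2]

theorem aligned_one (a : List B) : cs.Aligned a 1 := by
  constructor <;> simp

theorem Aligned.cons {d : List B} {w : W} (h : cs.Aligned d w) {s : B} (hs : s ∉ d) :
    cs.Aligned (s :: d) w :=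
  h.of_supported {k | k ∈ d} h.supported (fun _ hk => List.mem_cons_of_mem _ hk)
    fun _ _ h1 h2 => (CoxeterMatrix.omega_cons_of_apply_eq_zero d (h1 s hs) (h2 s hs)).symm

theorem Aligned.append {d : List B} {w : W} (h : cs.Aligned d w) {s : B} (hs : s ∉ d) :
    cs.Aligned (d ++ [s]) w :=
  h.of_supported {k | k ∈ d} h.supported (fun _ hk => List.mem_append_left _ hk)
    fun _ _ h1 h2 => (CoxeterMatrix.omega_append_of_apply_eq_zero d (h1 s hs) (h2 s hs)).symm

theorem Aligned.of_cons {d : List B} {w : W} {s : B} (h : cs.Aligned (s :: d) w) (hs : s ∉ d)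
    (hw : ∀ β ∈ cs.inversions w, ∀ k ∉ d, β k = 0) : cs.Aligned d w :=
  h.of_supported {k | k ∈ d} hw (fun _ hk => hk)
    fun _ _ h1 h2 => CoxeterMatrix.omega_cons_of_apply_eq_zero d (h1 s hs) (h2 s hs)

/-- The reflection s preserves ω and permutes the positive roots other than α_s. The case β = α_s is
excluded by the sign of ω at the last letter. If γ = α_s, then sβ lies in the cone of two inversions
of w, namely α_s and s(xβ + yα_s). -/
theorem Aligned.rotate {s : B} {d : List B} (hn : (s :: d).Nodup) {w : W}
    (hw : simpleRoot s ∈ cs.inversions w) (h : cs.Aligned (s :: d) w) :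
    cs.Aligned (d ++ [s]) (cs.simple s * w) := by
  have hs := (List.nodup_cons.1 hn).1
  have hsw : simpleRoot s ∉ cs.inversions (cs.simple s * w) := by
    rw [simpleRoot_mem_inversions_simple_mul_iff, not_not]; exact hw
  have hmem : ∀ β ∈ cs.inversions (cs.simple s * w),
      cs.geomRep (cs.simple s) β ∈ cs.inversions w := fun β hβ =>
    (mem_inversions_simple_mul_iff hβ.1 hβ.2.1 (by rintro rfl; exact hsw hβ) w).1 hβ
  have hsupp : ∀ β ∈ cs.inversions (cs.simple s * w), ∀ k ∉ s :: d, β k = 0 := by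
    intro β hβ k hk
    rw [← geomRep_simple_apply_of_ne (cs := cs) (i := s) (by rintro rfl; simp at hk)]
    exact h.supported _ (hmem β hβ) k hk
  refine ⟨fun β hβ k hk => hsupp β hβ k (by simpa [or_comm] using hk), ?_⟩
  intro β γ hβ hβ0 hγ hγ0 x y hx hy hm ho
  have hbs : β ≠ simpleRoot s := by
    rintro rfl
    exact absurd ho (not_lt.2 (CoxeterMatrix.omega_append_simpleRoot_left_nonpos hs hγ0))
  have hβ' := hβ.simple_nonneg hβ0 hbs
  rw [mem_inversions_simple_mul_iff hβ hβ0 hbs]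
  have hm' := hmem _ hm
  rw [map_add, map_smul, map_smul] at hm'
  by_cases hgs : γ = simpleRoot s
  · subst hgs
    rw [geomRep_simple_self] at hm'
    have e : cs.geomRep (cs.simple s) β =
        x⁻¹ • (x • cs.geomRep (cs.simple s) β + y • -simpleRoot s) +
          (x⁻¹ * y) • simpleRoot s := by
      rw [smul_add, smul_smul, inv_mul_cancel₀ hx.ne']; module
    have hr := hβ.geomRep (cs.simple s)
    rw [e] at hr ⊢
    exact inversions_closed hm' hw (by positivity) (by positivity) hr
  · refine h.mem_of_omega_pos _ (cs.geomRep (cs.simple s) γ) (hβ.geomRep _) hβ'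
      (hγ.geomRep _) (hγ.simple_nonneg hγ0 hgs) x y hx hy hm' ?_
    have hz := fun k (hk : k ∉ s :: d) => apply_eq_zero_of_add hβ0 hγ0 hx hy (hsupp _ hm k hk)
    have hz' : ∀ k ∉ s :: d, k ≠ s := by rintro k hk rfl; simp at hk
    rw [← omega_rotate (cs := cs) hn
      (fun k hk => by rw [geomRep_simple_apply_of_ne (hz' k hk)]; exact (hz k hk).1)
      (fun k hk => by rw [geomRep_simple_apply_of_ne (hz' k hk)]; exact (hz k hk).2)]
    simpa using ho

theorem Aligned.of_rotate {s : B} {d : List B} (hn : (s :: d).Nodup) {w : W}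
    (hw : simpleRoot s ∈ cs.inversions w) (h : cs.Aligned (d ++ [s]) (cs.simple s * w)) :
    cs.Aligned (s :: d) w := by
  have hs := (List.nodup_cons.1 hn).1
  have hmem : ∀ β ∈ cs.inversions w, β ≠ simpleRoot s →
      cs.geomRep (cs.simple s) β ∈ cs.inversions (cs.simple s * w) := by
    intro β hβ hne
    rw [mem_inversions_simple_mul_iff (hβ.1.geomRep _) (hβ.1.simple_nonneg hβ.2.1 hne)
      (hβ.1.simple_ne_simpleRoot hβ.2.1 s)]
    simpa using hβ
  have hsupp : ∀ β ∈ cs.inversions w, ∀ k ∉ s :: d, β k = 0 := by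
    intro β hβ k hk
    have hks : k ≠ s := by rintro rfl; simp at hk
    by_cases hb : β = simpleRoot s
    · subst hb; simp [Ne.symm hks]
    · rw [← geomRep_simple_apply_of_ne (cs := cs) hks]
      exact h.supported _ (hmem β hβ hb) k (by simpa [or_comm] using hk)
  refine ⟨hsupp, ?_⟩
  intro β γ hβ hβ0 hγ hγ0 x y hx hy hm ho
  by_cases hbs : β = simpleRoot s
  · rwa [hbs]
  have hgs : γ ≠ simpleRoot s := by
    rintro rfl
    exact absurd ho (not_lt.2 (CoxeterMatrix.omega_simpleRoot_right_nonpos hs hβ0))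
  have hds : x • β + y • γ ≠ simpleRoot s := fun hc =>
    hbs (hβ.eq_simpleRoot_of_add hβ0 hγ0 hx hy hc)
  have hm' := hmem _ hm hds
  rw [map_add, map_smul, map_smul] at hm'
  have hz := fun k (hk : k ∉ s :: d) => apply_eq_zero_of_add hβ0 hγ0 hx hy (hsupp _ hm k hk)
  have hβ' := hβ.simple_nonneg hβ0 hbs
  have := h.mem_of_omega_pos _ _ (hβ.geomRep _) hβ' (hγ.geomRep _)
    (hγ.simple_nonneg hγ0 hgs) x y hx hy hm' (by
      rw [omega_rotate hn (fun k hk => (hz k hk).1) (fun k hk => (hz k hk).2)]; exact ho)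
  rw [mem_inversions_simple_mul_iff (hβ.geomRep _) hβ' (hβ.simple_ne_simpleRoot hβ0 s)] at this
  simpa using this

/-! ### Alignment is recursive sortability -/

variable (cs) in
/-- The recursive description of the sortable elements, for a word `a` without repeated letters. -/
inductive RecSortable : List B → W → Prop
  | one (a : List B) : RecSortable a 1
  | use (s : B) (d : List B) (w : W) (hw : cs.IsLeftDescent w s)
      (h : RecSortable (d ++ [s]) (cs.simple s * w)) : RecSortable (s :: d) w
  | skip (s : B) (d : List B) (w : W) (h : RecSortable d w) : RecSortable (s :: d) w

variable (cs) in
/-- The roots `β_j = s₁ ⋯ s_{j-1} α_j` attached to a word. -/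
noncomputable def rootSeq : List B → List (B →₀ ℝ)
  | [] => []
  | r :: L => simpleRoot r :: (rootSeq L).map (cs.geomRep (cs.simple r))

theorem rootSeq_append_singleton (L : List B) (q : B) :
    cs.rootSeq (L ++ [q]) = cs.rootSeq L ++ [cs.geomRep (cs.wordProd L) (simpleRoot q)] := by
  induction L with
  | nil => simp [rootSeq]
  | cons r L ih =>
    rw [List.cons_append, rootSeq, ih, rootSeq, wordProd_cons]
    simp

theorem nodup_rotate {s : B} {d : List B} (hn : (s :: d).Nodup) : (d ++ [s]).Nodup :=
  (List.perm_append_singleton s d).nodup_iff.2 hn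

theorem wordProd_mem_parabolic {J : Set B} {L : List B} (h : ∀ q ∈ L, q ∈ J) :
    cs.wordProd L ∈ cs.parabolic J := by
  induction L with
  | nil => simp [one_mem]
  | cons r L ih =>
    rw [wordProd_cons]
    exact mul_mem (simple_mem_parabolic (h r (by simp))) (ih fun q hq => h q (by simp [hq]))

/-- The word records the letters used by the recursion. A new first root α_s pairs with a positive
root y to y_s ≥ 0, and rotation preserves the pairings already obtained. -/
theorem RecSortable.exists_word {a : List B} {w : W} (h : cs.RecSortable a w) (ha : a.Nodup) :
    ∃ L : List B, cs.wordProd L = w ∧ (∀ q ∈ L, q ∈ a) ∧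
      (∀ Γ ∈ cs.rootSeq L, Γ ∈ cs.inversions w) ∧
      (cs.rootSeq L).Pairwise fun x y => 0 ≤ M.eulerForm a x y := by
  induction h with
  | one a => exact ⟨[], by simp [rootSeq]⟩
  | use s d w hw _ ih =>
    obtain ⟨L, h1, h2, h3, h4⟩ := ih (nodup_rotate ha)
    have hs := (List.nodup_cons.1 ha).1
    have hsw : simpleRoot s ∉ cs.inversions (cs.simple s * w) := by
      rw [simpleRoot_mem_inversions_simple_mul_iff, not_not]
      exact simpleRoot_mem_inversions_iff.2 hw
    have hmem : ∀ Γ ∈ cs.rootSeq L, cs.geomRep (cs.simple s) Γ ∈ cs.inversions w := fun Γ hΓ =>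
      (mem_inversions_simple_mul_iff (h3 Γ hΓ).1 (h3 Γ hΓ).2.1
        (by rintro rfl; exact hsw (h3 _ hΓ)) w).1 (h3 Γ hΓ)
    have hsupp : ∀ Γ ∈ cs.rootSeq L, ∀ k ∉ s :: d, Γ k = 0 := fun Γ hΓ k hk =>
      apply_eq_zero_of_mem_inversions (J := {k | k ∈ s :: d})
        (h1 ▸ wordProd_mem_parabolic fun q hq => by simpa [or_comm] using h2 q hq) (h3 Γ hΓ) hk
    refine ⟨s :: L, by rw [wordProd_cons, h1, simple_mul_simple_cancel_left], ?_, ?_, ?_⟩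
    · intro q hq
      rcases List.mem_cons.1 hq with rfl | hq
      · simp
      · simpa [or_comm] using h2 q hq
    · intro Γ hΓ
      rcases List.mem_cons.1 hΓ with rfl | hΓ
      · exact simpleRoot_mem_inversions_iff.2 hw
      · obtain ⟨Γ', hΓ', rfl⟩ := List.mem_map.1 hΓ
        exact hmem Γ' hΓ'
    · rw [rootSeq, List.pairwise_cons, List.pairwise_map]
      refine ⟨fun Γ hΓ => ?_, h4.imp_of_mem fun {x y} hx hy hxy => ?_⟩
      · obtain ⟨Γ', hΓ', rfl⟩ := List.mem_map.1 hΓ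
        rw [CoxeterMatrix.eulerForm_simpleRoot_left hs]
        exact (hmem Γ' hΓ').2.1 s
      · have hz : ∀ z ∈ cs.rootSeq L, ∀ k ∉ s :: d, cs.geomRep (cs.simple s) z k = 0 := by
          intro z hz k hk
          rw [geomRep_simple_apply_of_ne (by rintro rfl; simp at hk)]
          exact hsupp z hz k hk
        rw [← eulerForm_rotate (cs := cs) ha (hz x hx) (hz y hy)]
        simpa using hxy
  | skip s d w _ ih =>
    obtain ⟨hs, hd⟩ := List.nodup_cons.1 ha
    obtain ⟨L, h1, h2, h3, h4⟩ := ih hd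
    refine ⟨L, h1, fun q hq => List.mem_cons_of_mem _ (h2 q hq), h3,
      h4.imp_of_mem fun {x y} _ hy hxy => ?_⟩
    rwa [CoxeterMatrix.eulerForm_cons_of_apply_eq_zero]
    exact apply_eq_zero_of_mem_inversions (J := {k | k ∈ d})
      (h1 ▸ wordProd_mem_parabolic fun q hq => h2 q hq) (h3 y hy) hs

theorem RecSortable.mem_parabolic {a : List B} {w : W} (h : cs.RecSortable a w) :
    w ∈ cs.parabolic {k | k ∈ a} := by
  induction h with
  | one a => exact one_mem _
  | use s d w _ _ ih =>
    have h1 := mul_mem (simple_mem_parabolic (cs := cs) (J := {k | k ∈ s :: d}) (i := s) (by simp))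
      (parabolic_mono (K := {k | k ∈ s :: d}) (fun k hk => by
        simpa [or_comm] using hk) ih)
    simpa using h1
  | skip s d w _ ih => exact parabolic_mono (fun k hk => by simpa using Or.inr hk) ih

/-- If `s` is initial and is not an inversion of the aligned element `w`, then neither is any root
`u α_s` with `u` sortable. -/
theorem Aligned.geomRep_simpleRoot_not_mem {s : B} {d : List B} (hn : (s :: d).Nodup) {u w : W}
    (hw : cs.Aligned (s :: d) w) (hsw : simpleRoot s ∉ cs.inversions w)
    (hu : cs.RecSortable d u) : cs.geomRep u (simpleRoot s) ∉ cs.inversions w := by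
  obtain ⟨hs, hd⟩ := List.nodup_cons.1 hn
  obtain ⟨L, rfl, hL, hroots, hpair⟩ := hu.exists_word hd
  have hpos : ∀ Γ ∈ cs.rootSeq L, cs.IsRoot Γ ∧ 0 ≤ Γ ∧ ∀ k ∉ d, Γ k = 0 := fun Γ hΓ =>
    ⟨(hroots Γ hΓ).1, (hroots Γ hΓ).2.1, fun k hk =>
      apply_eq_zero_of_mem_inversions (J := {k | k ∈ d}) (wordProd_mem_parabolic hL)
        (hroots Γ hΓ) hk⟩
  clear hroots hu
  -- The second clause is what the induction needs: it makes the Euler form of β = vα_s with the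
  -- next root γ₀ of the sequence nonnegative.
  suffices cs.geomRep (cs.wordProd L) (simpleRoot s) ∉ cs.inversions w ∧
      ∀ γ : B →₀ ℝ, (∀ k ∉ d, γ k = 0) → (∀ Γ ∈ cs.rootSeq L, 0 ≤ M.eulerForm d Γ γ) →
        0 ≤ M.eulerForm (s :: d) (cs.geomRep (cs.wordProd L) (simpleRoot s)) γ from this.1
  induction L using List.reverseRecOn with
  | nil =>
    refine ⟨by simpa using hsw, fun γ hγ _ => ?_⟩
    rw [wordProd_nil, geomRep_one, CoxeterMatrix.eulerForm_simpleRoot_left hs, hγ s hs]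
  | append_singleton L q ih =>
    rw [rootSeq_append_singleton] at hpair hpos
    rw [List.pairwise_append] at hpair
    obtain ⟨ih1, ih2⟩ := ih (fun p hp => hL p (by simp [hp])) hpair.1
      fun Γ hΓ => hpos Γ (by simp [hΓ])
    set v := cs.wordProd L with hv
    set γ₀ := cs.geomRep v (simpleRoot q) with hγ₀
    obtain ⟨hr, h0, hsupp⟩ := hpos γ₀ (by simp)
    have hqd : q ∈ d := hL q (by simp)
    have hqs : q ≠ s := by rintro rfl; exact hs hqd
    have hk := M.pairing_nonpos hqs
    have hE := ih2 γ₀ hsupp fun Γ hΓ => hpair.2.2 Γ hΓ γ₀ (by simp)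
    have hvJ : v ∈ cs.parabolic {k | k ∈ d} :=
      wordProd_mem_parabolic fun p hp => hL p (by simp [hp])
    set β := cs.geomRep v (simpleRoot s) with hβ
    have hβs : β s = 1 := by
      rw [hβ, geomRep_apply_of_mem_parabolic hvJ hs]; simp
    have hβr : cs.IsRoot β := (cs.isRoot_simpleRoot s).geomRep v
    have hβ0 : 0 ≤ β := hβr.nonneg_or_nonpos.resolve_right fun hc => by
      have : β s ≤ 0 := hc s
      linarith
    have hβsupp : ∀ k ∉ s :: d, β k = 0 := fun k hk => by
      rw [hβ, geomRep_apply_of_mem_parabolic hvJ (fun hc => hk (List.mem_cons_of_mem _ hc))]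
      have : s ≠ k := by rintro rfl; simp at hk
      simp [this]
    have hstep : cs.geomRep (cs.wordProd (L ++ [q])) (simpleRoot s) =
        β + (-M.pairing q s) • γ₀ := by
      rw [wordProd_append, wordProd_singleton, geomRep_mul, geomRep_simple_single, map_sub,
        map_smul, ← hv]
      module
    rw [hstep]
    constructor
    · intro hm
      rcases hk.lt_or_eq with hk | hk
      · refine ih1 (hw.mem_of_omega_pos β γ₀ hβr hβ0 hr h0 1 _ one_pos (neg_pos.2 hk)
          (by rwa [one_smul]) ?_)
        -- The two Euler values of β and γ₀ add up to the pairing of q and s, which is negative, and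
        -- E(β, γ₀) ≥ 0. So ω(β, γ₀) > 0, and alignment would make β an inversion.
        have h2 := CoxeterMatrix.eulerForm_add_swap (M := M) hn hβsupp
          (fun k hk => hsupp k fun hc => hk (List.mem_cons_of_mem _ hc))
        rw [hβ, hγ₀, form_geomRep, M.form_single, one_mul, one_mul, ← hβ, ← hγ₀,
          M.pairing_comm] at h2
        unfold CoxeterMatrix.omega
        linarith
      · rw [hk, neg_zero, zero_smul, add_zero] at hm
        exact ih1 hm
    · intro γ hγ hΓ
      rw [CoxeterMatrix.eulerForm_add_left, CoxeterMatrix.eulerForm_smul_left,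
        CoxeterMatrix.eulerForm_cons_of_apply_eq_zero d (x := γ₀) (hγ s hs)]
      rw [rootSeq_append_singleton] at hΓ
      exact add_nonneg (ih2 γ hγ fun Γ h => hΓ Γ (by simp [h]))
        (mul_nonneg (neg_nonneg.2 hk) (hΓ γ₀ (List.mem_append_right _ (List.mem_singleton.2 rfl))))

/-- Induction on word length plus element length. If α_s is an inversion, rotate. Otherwise let w =
uz with u the part of w in W_d. If z ≠ 1, its left descent can only be s, so uα_s would be an
inversion of w, which `Aligned.geomRep_simpleRoot_not_mem` forbids. -/
theorem Aligned.recSortable {a : List B} (ha : a.Nodup) {w : W} (h : cs.Aligned a w) :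
    cs.RecSortable a w := by
  induction hN : a.length + cs.length w using Nat.strong_induction_on generalizing a w with
  | _ N IH =>
  subst hN
  cases a with
  | nil =>
    have : w = 1 := eq_one_of_inversions_eq_empty (cs := cs) (by
      refine Set.eq_empty_iff_forall_notMem.2 fun β hβ => hβ.1.ne_zero ?_
      exact Finsupp.ext fun k => h.supported β hβ k (by simp))
    rw [this]
    exact .one _
  | cons s d =>
    obtain ⟨hs, hd⟩ := List.nodup_cons.1 ha
    by_cases hsw : simpleRoot s ∈ cs.inversions w
    · have hdes := simpleRoot_mem_inversions_iff.1 hsw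
      refine .use s d w hdes (IH _ ?_ (nodup_rotate ha) (h.rotate ha hsw) rfl)
      have := cs.isLeftDescent_iff.1 hdes
      simp only [List.length_append, List.length_cons, List.length_nil]
      omega
    · obtain ⟨u, hu, z, hz, hz'⟩ := cs.exists_parabolic_factorization {k | k ∈ d} w
      have hinv : ∀ β, β ∈ cs.inversions u ↔ β ∈ cs.inversions w ∧ ∀ k ∉ d, β k = 0 := fun β => by
        rw [hz]; exact mem_inversions_parabolic_part_iff hu hz'
      have hua : cs.Aligned d u := by
        refine Aligned.of_cons (s := s) ⟨fun β hβ k hk => ?_, ?_⟩ hs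
          fun β hβ => ((hinv β).1 hβ).2
        · exact ((hinv β).1 hβ).2 k fun hc => hk (List.mem_cons_of_mem _ hc)
        · intro β γ hβ hβ0 hγ hγ0 x y hx hy hm ho
          obtain ⟨hm1, hm2⟩ := (hinv _).1 hm
          exact (hinv β).2 ⟨h.mem_of_omega_pos β γ hβ hβ0 hγ hγ0 x y hx hy hm1 ho,
            fun k hk => (apply_eq_zero_of_add hβ0 hγ0 hx hy (hm2 k hk)).1⟩
      have hul : cs.length u ≤ cs.length w :=
        (weakLE_iff_inversions_subset.2 fun β hβ => ((hinv β).1 hβ).1).length_le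
      have hus := IH _ (by simp; omega) hd hua rfl
      have hnot := h.geomRep_simpleRoot_not_mem ha hsw hus
      have hwu : w = u := by
        by_cases hz1 : z = 1
        · rw [hz, hz1, mul_one]
        exfalso
        obtain ⟨i, hi⟩ := cs.exists_leftDescent_of_ne_one hz1
        have hid : i ∉ d := fun hc => by
          have := hz' i hc
          unfold IsLeftDescent at hi
          omega
        have hzJ : z ∈ cs.parabolic {k | k ∈ s :: d} := by
          have hw' : w ∈ cs.parabolic {k | k ∈ s :: d} := mem_parabolic_iff.2 h.supported
          have hu' := parabolic_mono (cs := cs) (K := {k | k ∈ s :: d})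
            (fun k hk => by simpa using Or.inr hk) hu
          have : z = u⁻¹ * w := by rw [hz]; group
          rw [this]
          exact mul_mem (inv_mem hu') hw'
        have hizi := simpleRoot_mem_inversions_iff.2 hi
        have his : i = s := by
          by_contra hne
          have := apply_eq_zero_of_mem_inversions hzJ hizi (k := i) (by simp [hne, hid])
          simp at this
        subst his
        have hr := (cs.isRoot_simpleRoot i).geomRep u
        have h1 : cs.geomRep u (simpleRoot i) i = 1 := by
          rw [geomRep_apply_of_mem_parabolic hu hid]; simp
        refine hnot ⟨hr, hr.nonneg_or_nonpos.resolve_right fun hc => ?_, ?_⟩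
        · have : cs.geomRep u (simpleRoot i) i ≤ 0 := hc i
          linarith
        · rw [hz, mul_inv_rev, geomRep_mul, geomRep_inv_apply]
          exact hizi.2.2
      rw [hwu]
      exact .skip s d u hus

theorem RecSortable.aligned {a : List B} (ha : a.Nodup) {w : W} (h : cs.RecSortable a w) :
    cs.Aligned a w := by
  induction h with
  | one a => exact aligned_one a
  | use s d w hw _ ih =>
    exact (ih (nodup_rotate ha)).of_rotate ha (simpleRoot_mem_inversions_iff.2 hw)
  | skip s d w _ ih =>
    obtain ⟨hs, hd⟩ := List.nodup_cons.1 ha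
    exact (ih hd).cons hs

theorem Aligned.tail {s : B} {d : List B} (hn : (s :: d).Nodup) {w : W}
    (h : cs.Aligned (s :: d) w) (hsw : simpleRoot s ∉ cs.inversions w) : cs.Aligned d w := by
  cases h.recSortable hn with
  | one => exact aligned_one d
  | use _ _ _ hw => exact absurd (simpleRoot_mem_inversions_iff.2 hw) hsw
  | skip _ _ _ h => exact h.aligned (List.nodup_cons.1 hn).2

/-! ### Minimal upper bounds of aligned elements -/

theorem inversions_simple (s : B) : cs.inversions (cs.simple s) = {simpleRoot s} := by
  have := inversions_mul_simple (cs := cs) (w := 1) (i := s) (by simp)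
  simpa using this

theorem aligned_simple {a : List B} {s : B} (hs : s ∈ a) : cs.Aligned a (cs.simple s) := by
  constructor
  · intro β hβ k hk
    rw [inversions_simple] at hβ
    have : s ≠ k := by rintro rfl; exact hk hs
    rw [hβ]; simp [this]
  · intro β γ hβ hβ0 hγ hγ0 x y hx hy hm _
    rw [inversions_simple] at hm ⊢
    exact hβ.eq_simpleRoot_of_add hβ0 hγ0 hx hy hm

variable (cs) in
/-- Minimality of an upper bound, expressed through cover roots. -/
def CoversIn (x : W) (N : Set (B →₀ ℝ)) : Prop :=
  ∀ i, cs.IsRightDescent x i → -cs.geomRep x (simpleRoot i) ∈ N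

theorem CoversIn.supported {x : W} {N : Set (B →₀ ℝ)} (h : cs.CoversIn x N) {J : Set B}
    (hN : ∀ β ∈ N, ∀ k ∉ J, β k = 0) : ∀ β ∈ cs.inversions x, ∀ k ∉ J, β k = 0 :=
  mem_parabolic_iff.1 (mem_parabolic_of_cover_roots fun i hi k hk => by
    simpa using hN _ (h i hi) k hk)

/-- The longest element of a rank two standard parabolic subgroup is aligned for any
orientation. -/
theorem aligned_of_supported_pair {a : List B} {r s : B} (hr : r ∈ a) (hs : s ∈ a) (hrs : r ≠ s)
    {x : W} (hrx : simpleRoot r ∈ cs.inversions x) (hsx : simpleRoot s ∈ cs.inversions x)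
    (hx : ∀ β ∈ cs.inversions x, ∀ k ∉ ({r, s} : Set B), β k = 0) : cs.Aligned a x := by
  constructor
  · intro β hβ k hk
    refine hx β hβ k ?_
    rintro (rfl | rfl)
    exacts [hk hr, hk hs]
  · intro β γ hβ hβ0 hγ hγ0 y z hy hz hm _
    have hβ' : β = β r • simpleRoot r + β s • simpleRoot s := by
      ext k
      by_cases hkr : k = r
      · subst hkr; simp [hrs.symm]
      · by_cases hks : k = s
        · subst hks; simp [hrs]
        · have := (apply_eq_zero_of_add hβ0 hγ0 hy hz (hx _ hm k (by simp [hkr, hks]))).1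
          simp [Ne.symm hkr, Ne.symm hks, this]
    rw [hβ'] at hβ ⊢
    exact inversions_closed hrx hsx (hβ0 r) (hβ0 s) hβ

/-- A minimal upper bound in the weak order of two aligned elements is aligned. -/
theorem aligned_of_coversIn {a : List B} (ha : a.Nodup) {x v₁ v₂ : W}
    (h₁ : cs.Aligned a v₁) (h₂ : cs.Aligned a v₂) (hx₁ : cs.inversions v₁ ⊆ cs.inversions x)
    (hx₂ : cs.inversions v₂ ⊆ cs.inversions x)
    (hx : cs.CoversIn x (cs.inversions v₁ ∪ cs.inversions v₂)) : cs.Aligned a x := by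
  induction hN : a.length + cs.length x using Nat.strong_induction_on
    generalizing a x v₁ v₂ with
  | _ N IH =>
  subst hN
  -- both elements lie above the initial letter
  have both : ∀ {s : B} {d : List B} {v₁ v₂ : W}, (s :: d).Nodup →
      d.length + 1 = a.length → cs.Aligned (s :: d) v₁ → cs.Aligned (s :: d) v₂ →
      cs.inversions v₁ ⊆ cs.inversions x → cs.inversions v₂ ⊆ cs.inversions x →
      cs.CoversIn x (cs.inversions v₁ ∪ cs.inversions v₂) →
      simpleRoot s ∈ cs.inversions v₁ → simpleRoot s ∈ cs.inversions v₂ →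
      cs.Aligned (s :: d) x := by
    -- Only the length of the word is fixed, because the claim is used both for the given word and
    -- for a rotation of it. Stripping s shortens x, and the cover roots of sx are the images under
    -- s of cover roots of x, so the induction hypothesis applies to the rotated word.
    intro s d v₁ v₂ hn hl h₁ h₂ hx₁ hx₂ hx hs₁ hs₂
    have hsx := hx₁ hs₁
    have hmono : ∀ {v : W}, simpleRoot s ∈ cs.inversions v →
        cs.inversions v ⊆ cs.inversions x →
        cs.inversions (cs.simple s * v) ⊆ cs.inversions (cs.simple s * x) := fun hv =>
      inversions_simple_mul_subset (by simp [hv, hsx])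
    refine Aligned.of_rotate hn hsx (IH _ ?_ (nodup_rotate hn) (h₁.rotate hn hs₁)
      (h₂.rotate hn hs₂) (hmono hs₁ hx₁) (hmono hs₂ hx₂) ?_ rfl)
    · have := cs.isLeftDescent_iff.1 (simpleRoot_mem_inversions_iff.1 hsx)
      simp only [List.length_append, List.length_cons, List.length_nil]
      omega
    · intro i hi
      have hκ := neg_geomRep_mem_inversions hi
      have hκ' : cs.geomRep (cs.simple s) (-cs.geomRep (cs.simple s * x) (simpleRoot i)) =
          -cs.geomRep x (simpleRoot i) := by
        rw [map_neg, geomRep_mul, geomRep_simple_simple]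
      have hne : -cs.geomRep (cs.simple s * x) (simpleRoot i) ≠ simpleRoot s := by
        intro hc
        rw [hc, simpleRoot_mem_inversions_simple_mul_iff] at hκ
        exact hκ hsx
      have hpos := hκ.1.simple_nonneg hκ.2.1 hne
      rw [hκ'] at hpos
      have hi' : cs.IsRightDescent x i :=
        geomRep_simpleRoot_nonpos_iff.1 (neg_nonneg.1 hpos)
      rcases hx i hi' with h | h
      · left
        rw [mem_inversions_simple_mul_iff hκ.1 hκ.2.1 hne, hκ']
        exact h
      · right
        rw [mem_inversions_simple_mul_iff hκ.1 hκ.2.1 hne, hκ']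
        exact h
  cases a with
  | nil =>
    have := hx.supported (J := ∅) (fun β hβ k _ => by
      rcases hβ with hβ | hβ
      · exact h₁.supported β hβ k (by simp)
      · exact h₂.supported β hβ k (by simp))
    have hx1 : x = 1 := eq_one_of_inversions_eq_empty (cs := cs) (by
      refine Set.eq_empty_iff_forall_notMem.2 fun β hβ => hβ.1.ne_zero ?_
      exact Finsupp.ext fun k => this β hβ k (by simp))
    rw [hx1]
    exact aligned_one _
  | cons s d =>
    obtain ⟨hs, hd⟩ := List.nodup_cons.1 ha
    -- the minimal upper bound of the initial letter and an element avoiding it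
    have crux : ∀ {v : W}, cs.Aligned (s :: d) v → simpleRoot s ∉ cs.inversions v →
        simpleRoot s ∈ cs.inversions x → cs.inversions v ⊆ cs.inversions x →
        cs.CoversIn x (insert (simpleRoot s) (cs.inversions v)) → cs.Aligned (s :: d) x := by
      intro v hv hsv hsx hvx hc
      have hv' := hv.tail ha hsv
      have hsimple : cs.inversions (cs.simple s) ∪ cs.inversions v =
          insert (simpleRoot s) (cs.inversions v) := by
        rw [inversions_simple]; rfl
      have hsx' : cs.inversions (cs.simple s) ⊆ cs.inversions x := by
        rw [inversions_simple]; simpa using hsx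
      cases d with
      | nil =>
        have hsupp : ∀ β ∈ cs.inversions x, ∀ k ∉ ({s} : Set B), β k = 0 := by
          refine hc.supported fun β hβ k hk => ?_
          rcases hβ with rfl | hβ
          · have : s ≠ k := fun h => hk h.symm
            simp [this]
          · exact hv'.supported β hβ k (by simp)
        refine ⟨fun β hβ k hk => hsupp β hβ k (by simpa using hk), ?_⟩
        intro β γ hβ hβ0 hγ hγ0 y z hy hz hm _
        have := hβ.eq_simpleRoot hβ0 fun k hk =>
          (apply_eq_zero_of_add hβ0 hγ0 hy hz (hsupp _ hm k hk)).1
        rwa [this]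
      | cons r e =>
        obtain ⟨hr, he⟩ := List.nodup_cons.1 hd
        have hsr : s ≠ r := by rintro rfl; simp at hs
        have hse : s ∉ e := fun h => hs (by simp [h])
        -- If the second letter r lies below v, let g be a minimal upper bound of r and s below x.
        -- Then g and v both lie above r, the first letter of the rotated word, and the previous
        -- case applies to them.
        by_cases hrv : simpleRoot r ∈ cs.inversions v
        · -- `x` is aligned for the rotated word
          obtain ⟨g, hgx, hNg, hcg⟩ := exists_minimal_upper_bound (cs := cs) (w := x)
            (N := {simpleRoot r, simpleRoot s}) (by
              rintro β (rfl | rfl)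
              exacts [hvx hrv, hsx])
          have hrg : simpleRoot r ∈ cs.inversions g := hNg (by simp)
          have hsg : simpleRoot s ∈ cs.inversions g := hNg (by simp)
          have hg : cs.Aligned (r :: (e ++ [s])) g := by
            refine aligned_of_supported_pair (by simp) (by simp) hsr.symm hrg hsg ?_
            refine CoversIn.supported hcg ?_
            rintro β (rfl | rfl) k hk
            · have : r ≠ k := by rintro rfl; simp at hk
              simp [this]
            · have : s ≠ k := by rintro rfl; simp at hk
              simp [this]
          have hxr : cs.Aligned ((r :: e) ++ [s]) x := by
            refine both (s := r) (d := e ++ [s]) (nodup_rotate ha) (by simp) hg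
              (hv'.append hs) hgx hvx ?_ hrg hrv
            intro i hi
            rcases hc i hi with h | h
            · left; rw [h]; exact hsg
            · exact Or.inr h
          -- `s` is a cover root of `x`
          obtain ⟨i, hi, hi'⟩ : ∃ i, cs.IsRightDescent x i ∧
              -cs.geomRep x (simpleRoot i) = simpleRoot s := by
            -- Otherwise all cover roots of x are inversions of v, hence supported away from s,
            -- which puts x in a parabolic subgroup omitting s although α_s is an inversion of x.
            by_contra hcon
            push Not at hcon
            have : cs.CoversIn x (cs.inversions v) := fun i hi =>
              (hc i hi).resolve_left (hcon i hi)
            have := this.supported (J := {k | k ∈ r :: e}) hv'.supported _ hsx s hs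
            simp at this
          have hsx_eq := simple_mul_eq_mul_simple (cs := cs) (w := x) (i := i) (j := s)
            (by rw [← hi', neg_neg])
          have hinv : ∀ β, β ∈ cs.inversions (cs.simple s * x) ↔
              β ∈ cs.inversions x ∧ β ≠ simpleRoot s := fun β => by
            rw [hsx_eq, mem_inversions_mul_simple_iff hi, hi']
          -- Passing from x to sx removes just the inversion α_s. Alignment for the rotated word
          -- survives, since ω(α_s, γ) ≤ 0 there, and rotating back returns to x and the original
          -- word.
          refine Aligned.of_rotate ha hsx ⟨fun β hβ => hxr.supported β ((hinv β).1 hβ).1, ?_⟩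
          intro β γ hβ hβ0 hγ hγ0 y z hy hz hm ho
          refine (hinv β).2 ⟨hxr.mem_of_omega_pos β γ hβ hβ0 hγ hγ0 y z hy hz
            ((hinv _).1 hm).1 ho, ?_⟩
          rintro rfl
          exact absurd ho
            (not_lt.2 (CoxeterMatrix.omega_append_simpleRoot_left_nonpos hs hγ0))
        -- Here v avoids r too, so the cover roots of x have no r-coordinate and r can be deleted
        -- from the word.
        · have hve := hv'.tail hd hrv
          have hxe : cs.Aligned (s :: e) x :=
            IH _ (by simp) (List.nodup_cons.2 ⟨hse, he⟩)
              (aligned_simple (a := s :: e) (s := s) (by simp)) (hve.cons hse)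
              hsx' hvx (by rw [hsimple]; exact hc) rfl
          refine hxe.of_supported {k | k ∈ s :: e} hxe.supported (fun k hk => ?_)
            fun β γ hβ hγ => (CoxeterMatrix.omega_cons_cons_of_apply_eq_zero e
              (hβ r (by simp [hsr.symm, hr])) (hγ r (by simp [hsr.symm, hr]))).symm
          rcases List.mem_cons.1 hk with rfl | hk
          · simp
          · simp [hk]
    -- one element above the initial letter, the other one not
    have mixed : ∀ {v₁ v₂ : W}, cs.Aligned (s :: d) v₁ → cs.Aligned (s :: d) v₂ →
        cs.inversions v₁ ⊆ cs.inversions x → cs.inversions v₂ ⊆ cs.inversions x →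
        cs.CoversIn x (cs.inversions v₁ ∪ cs.inversions v₂) →
        simpleRoot s ∈ cs.inversions v₁ → simpleRoot s ∉ cs.inversions v₂ →
        cs.Aligned (s :: d) x := by
      intro v₁ v₂ h₁ h₂ hx₁ hx₂ hx hs₁ hs₂
      -- Let x' be a minimal upper bound of s and v₂ below x. If x' = x the previous claim applies;
      -- otherwise x' is shorter, hence aligned by induction, and replaces v₂ as an element above s.
      obtain ⟨x', hx'x, hNx', hcx'⟩ := exists_minimal_upper_bound (cs := cs) (w := x)
        (N := insert (simpleRoot s) (cs.inversions v₂))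
        (Set.insert_subset (hx₁ hs₁) hx₂)
      have hsx' : simpleRoot s ∈ cs.inversions x' := hNx' (by simp)
      have hvx' : cs.inversions v₂ ⊆ cs.inversions x' := (Set.subset_insert _ _).trans hNx'
      by_cases hlen : cs.length x ≤ cs.length x'
      · have hxx : x' = x := (weakLE_iff_inversions_subset.2 hx'x).eq_of_length_le hlen
        rw [hxx] at hcx'
        exact crux h₂ hs₂ (hx₁ hs₁) hx₂ hcx'
      · have hx'a : cs.Aligned (s :: d) x' :=
          IH _ (by omega) ha (aligned_simple (a := s :: d) (s := s) (by simp)) h₂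
            (by rw [inversions_simple]; simpa using hsx') hvx'
            (by rw [inversions_simple]; exact hcx') rfl
        exact both ha rfl h₁ hx'a hx₁ hx'x
          (fun i hi => (hx i hi).imp id fun h => hvx' h) hs₁ hsx'
    by_cases hs₁ : simpleRoot s ∈ cs.inversions v₁ <;>
      by_cases hs₂ : simpleRoot s ∈ cs.inversions v₂
    · exact both ha rfl h₁ h₂ hx₁ hx₂ hx hs₁ hs₂
    · exact mixed h₁ h₂ hx₁ hx₂ hx hs₁ hs₂
    · exact mixed h₂ h₁ hx₂ hx₁ (by rwa [Set.union_comm]) hs₂ hs₁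
    · exact (IH _ (by simp) hd (h₁.tail ha hs₁) (h₂.tail ha hs₂) hx₁ hx₂ hx rfl).cons hs

/-- Take v aligned below w of greatest length. A minimal upper bound below w of v and a competitor x
is aligned, so by length it is v itself. -/
theorem exists_max_aligned {a : List B} (ha : a.Nodup) (w : W) :
    ∃ v, cs.Aligned a v ∧ cs.WeakLE v w ∧
      ∀ x, cs.Aligned a x → cs.WeakLE x w → cs.WeakLE x v := by
  classical
  let P : ℕ → Prop := fun n => ∃ v, cs.Aligned a v ∧ cs.WeakLE v w ∧ cs.length v = n
  have hP0 : P 0 := ⟨1, aligned_one a, weakLE_iff_inversions_subset.2 (by simp), by simp⟩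
  obtain ⟨v, hv, hvw, hvl⟩ := Nat.findGreatest_spec (P := P) (Nat.zero_le (cs.length w)) hP0
  refine ⟨v, hv, hvw, fun x hx hxw => ?_⟩
  rw [weakLE_iff_inversions_subset] at hvw hxw
  obtain ⟨y, hyw, hNy, hcy⟩ := exists_minimal_upper_bound (Set.union_subset hvw hxw)
  have hvy := Set.subset_union_left.trans hNy
  have hxy := Set.subset_union_right.trans hNy
  have hy := aligned_of_coversIn ha hv hx hvy hxy hcy
  have hyw' := weakLE_iff_inversions_subset.2 hyw
  have hle : cs.length y ≤ cs.length v := by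
    rw [hvl]
    exact Nat.le_findGreatest hyw'.length_le ⟨y, hy, hyw', rfl⟩
  have := (weakLE_iff_inversions_subset.2 hvy).eq_of_length_le hle
  rw [this]
  exact weakLE_iff_inversions_subset.2 hxy

/-! ### Words for a Coxeter element -/

theorem simple_mul_comm_of_pairing_eq_zero {i j : B} (hij : i ≠ j) (h : M.pairing i j = 0) :
    cs.simple i * cs.simple j = cs.simple j * cs.simple i := by
  have h2 := cs.simple_mul_simple_pow i j
  rw [M.eq_two_of_pairing_eq_zero hij h, pow_two] at h2
  have h3 := eq_inv_of_mul_eq_one_left h2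
  simpa using h3

theorem isReduced_of_nodup {a : List B} (ha : a.Nodup) : cs.IsReduced a := by
  induction a with
  | nil => simp [IsReduced]
  | cons s d ih =>
    obtain ⟨hs, hd⟩ := List.nodup_cons.1 ha
    have h1 : ¬ cs.IsLeftDescent (cs.wordProd d) s := by
      rw [← simpleRoot_mem_inversions_iff]
      intro hc
      have := apply_eq_zero_of_mem_inversions (J := {k | k ∈ d})
        (wordProd_mem_parabolic fun q hq => hq) hc hs
      simp at this
    rw [not_isLeftDescent_iff] at h1
    rw [IsReduced, wordProd_cons, h1, ih hd]
    simp

theorem IsCoxeterWord.isInitialLetter {J : Set B} {c : W} {s : B} {d : List B}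
    (h : cs.IsCoxeterWord J c (s :: d)) : cs.IsInitialLetter J c s :=
  ⟨d, fun j hj => (h.mem_iff j).1 hj, isReduced_of_nodup h.nodup, h.prod_eq⟩

theorem IsInitialLetter.mem {J : Set B} {c : W} {i : B} (h : cs.IsInitialLetter J c i) : i ∈ J := by
  obtain ⟨ω, h1, -⟩ := h
  exact h1 i (by simp)

theorem IsInitialLetter.simpleRoot_mem {J : Set B} {c : W} {i : B}
    (h : cs.IsInitialLetter J c i) : simpleRoot i ∈ cs.inversions c := by
  obtain ⟨ω, -, h1, rfl⟩ := h
  rw [simpleRoot_mem_inversions_iff, IsLeftDescent, h1.eq, wordProd_cons,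
    simple_mul_simple_cancel_left]
  have := cs.length_wordProd_le ω
  simp; omega

theorem IsCoxeterWord.tail {J : Set B} {c : W} {s : B} {d : List B}
    (h : cs.IsCoxeterWord J c (s :: d)) : cs.IsCoxeterWord (J \ {s}) (cs.simple s * c) d where
  nodup := (List.nodup_cons.1 h.nodup).2
  mem_iff i := by
    rw [Set.mem_sdiff, ← h.mem_iff, List.mem_cons, Set.mem_singleton_iff]
    have : s ∉ d := (List.nodup_cons.1 h.nodup).1
    constructor
    · exact fun hi => ⟨Or.inr hi, by rintro rfl; exact this hi⟩
    · rintro ⟨h1 | h1, h2⟩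
      exacts [absurd h1 h2, h1]
  prod_eq := by rw [← h.prod_eq, wordProd_cons, simple_mul_simple_cancel_left]

theorem IsCoxeterWord.rotate {J : Set B} {c : W} {s : B} {d : List B}
    (h : cs.IsCoxeterWord J c (s :: d)) :
    cs.IsCoxeterWord J (cs.simple s * c * cs.simple s) (d ++ [s]) where
  nodup := nodup_rotate h.nodup
  mem_iff i := by rw [← h.mem_iff]; simp [or_comm]
  prod_eq := by
    rw [← h.prod_eq, wordProd_cons, simple_mul_simple_cancel_left, wordProd_append,
      wordProd_singleton]

/-- A simple root moved by the inverse of a Coxeter word not containing it acquires further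
positive coordinates unless it commutes with all the letters. -/
theorem exists_pos_apply_geomRep_inv {i : B} {b : List B} (hb : (i :: b).Nodup)
    (h : ∃ q ∈ b, M.pairing q i ≠ 0) :
    ∃ k ∈ b, 0 < cs.geomRep (cs.wordProd b)⁻¹ (simpleRoot i) k := by
  induction b using List.reverseRecOn with
  | nil => simp at h
  | append_singleton b q ih =>
    have hperm : (i :: (b ++ [q])).Perm (q :: i :: b) :=
      ((List.perm_append_singleton q b).cons i).trans (List.Perm.swap q i b)
    have hnd := hperm.nodup_iff.1 hb
    obtain ⟨hq, hib⟩ := List.nodup_cons.1 hnd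
    have hqi : q ≠ i := fun h => hq (by simp [h])
    have hqb : q ∉ b := fun h => hq (by simp [h])
    have hi : i ∉ b := (List.nodup_cons.1 hib).1
    rw [wordProd_append, wordProd_singleton, mul_inv_rev, inv_simple]
    simp only [geomRep_mul]
    set x := cs.geomRep (cs.wordProd b)⁻¹ (simpleRoot i) with hx
    have hmem : (cs.wordProd b)⁻¹ ∈ cs.parabolic {k | k ∈ b} :=
      inv_mem (wordProd_mem_parabolic fun q hq => hq)
    by_cases hqc : M.pairing q i = 0
    · obtain ⟨r, hr, hr'⟩ := h
      have hrb : r ∈ b := by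
        rcases List.mem_append.1 hr with h | h
        · exact h
        · rw [List.mem_singleton.1 h] at hr'; exact absurd hqc hr'
      obtain ⟨k, hk, hk'⟩ := ih hib ⟨r, hrb, hr'⟩
      refine ⟨k, by simp [hk], ?_⟩
      rwa [geomRep_simple_apply_of_ne (by rintro rfl; exact hqb hk)]
    · refine ⟨q, by simp, ?_⟩
      have hxi : x i = 1 := by
        rw [hx, geomRep_apply_of_mem_parabolic hmem hi]; simp
      have hxr : cs.IsRoot x := (cs.isRoot_simpleRoot i).geomRep _
      have hx0 : 0 ≤ x := hxr.nonneg_or_nonpos.resolve_right fun hc => by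
        have : x i ≤ 0 := hc i
        linarith
      have hxs : ∀ k ∉ i :: b, x k = 0 := fun k hk => by
        rw [hx, geomRep_apply_of_mem_parabolic hmem fun hc => hk (List.mem_cons_of_mem _ hc)]
        have : i ≠ k := by rintro rfl; simp at hk
        simp [this]
      have hsum := CoxeterMatrix.sum_mul_pairing_nonpos (M := M) hqb hx0
      have hneg : M.pairing q i < 0 := lt_of_le_of_ne (M.pairing_nonpos hqi) hqc
      rw [geomRep_simple, CoxeterMatrix.form_simpleRoot_eq_sum hib hxs]
      simp only [List.map_cons, List.sum_cons, hxi, one_mul, Finsupp.sub_apply,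
        Finsupp.smul_apply, Finsupp.single_eq_same, smul_eq_mul, mul_one, hxs q hq,
        M.pairing_comm i q]
      linarith

theorem eulerForm_move {i : B} {b e : List B} (h : ∀ q ∈ b, M.pairing q i = 0)
    (x y : B →₀ ℝ) : M.eulerForm (b ++ i :: e) x y = M.eulerForm (i :: (b ++ e)) x y := by
  induction b with
  | nil => rfl
  | cons q b ih =>
    have hb : (b.map fun r => x r * M.pairing r i).sum = 0 :=
      List.sum_eq_zero fun t ht => by
        obtain ⟨r, hr, rfl⟩ := List.mem_map.1 ht
        rw [h r (by simp [hr]), mul_zero]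
    rw [List.cons_append, CoxeterMatrix.eulerForm, ih fun p hp => h p (by simp [hp])]
    simp only [CoxeterMatrix.eulerForm, List.cons_append, List.map_append, List.sum_append,
      List.map_cons, List.sum_cons, hb, h q (by simp), M.pairing_comm i q]
    ring

theorem wordProd_move {i : B} {b e : List B} (hi : i ∉ b) (h : ∀ q ∈ b, M.pairing q i = 0) :
    cs.wordProd (b ++ i :: e) = cs.wordProd (i :: (b ++ e)) := by
  induction b with
  | nil => rfl
  | cons q b ih =>
    have hqi : q ≠ i := by rintro rfl; simp at hi
    rw [List.cons_append, wordProd_cons, ih (fun hc => hi (by simp [hc]))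
      fun p hp => h p (by simp [hp]), wordProd_cons, wordProd_cons, List.cons_append,
      wordProd_cons, ← mul_assoc, ← mul_assoc,
      simple_mul_comm_of_pairing_eq_zero hqi (h q (by simp))]

/-- An initial letter of a Coxeter element can be moved to the front of any word for it. -/
theorem IsCoxeterWord.exists_cons {J : Set B} {c : W} {a : List B} {i : B}
    (ha : cs.IsCoxeterWord J c a) (hi : cs.IsInitialLetter J c i) :
    ∃ d, cs.IsCoxeterWord J c (i :: d) ∧
      ∀ x y, M.eulerForm a x y = M.eulerForm (i :: d) x y := by
  obtain ⟨b, e, rfl⟩ := List.append_of_mem ((ha.mem_iff i).2 hi.mem)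
  have hperm : (b ++ i :: e).Perm (i :: (b ++ e)) := List.perm_middle
  have hnd := hperm.nodup_iff.1 ha.nodup
  have hib : i ∉ b := fun h => (List.nodup_cons.1 hnd).1 (by simp [h])
  have hbn : (i :: b).Nodup :=
    List.nodup_cons.2 ⟨hib, (List.nodup_cons.1 hnd).2.sublist (List.sublist_append_left b e)⟩
  -- If a letter of the prefix b is not orthogonal to α_i, the inverse of b gives α_i a positive
  -- coordinate at some k in b. The remaining letters leave that coordinate alone, so c⁻¹α_i is not
  -- negative, although i is initial.
  have hcomm : ∀ q ∈ b, M.pairing q i = 0 := by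
    by_contra hc
    push Not at hc
    obtain ⟨k, hk, hk'⟩ := exists_pos_apply_geomRep_inv (cs := cs) hbn hc
    have h1 : cs.geomRep c⁻¹ (simpleRoot i) k ≤ 0 := hi.simpleRoot_mem.2.2 k
    have hke : k ∉ i :: e := by
      have := List.disjoint_of_nodup_append ha.nodup
      exact this hk
    rw [← ha.prod_eq, wordProd_append, mul_inv_rev, geomRep_mul,
      geomRep_apply_of_mem_parabolic (J := {k | k ∈ i :: e})
        (inv_mem (wordProd_mem_parabolic fun q hq => hq)) hke] at h1
    linarith
  refine ⟨b ++ e, ⟨hnd, fun j => by rw [← ha.mem_iff, hperm.mem_iff], ?_⟩,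
    eulerForm_move hcomm⟩
  rw [← wordProd_move hib hcomm, ha.prod_eq]

/-- The Euler form of a word for a Coxeter element depends only on the Coxeter element. -/
theorem IsCoxeterWord.eulerForm_eq {J : Set B} {c : W} {a b : List B}
    (ha : cs.IsCoxeterWord J c a) (hb : cs.IsCoxeterWord J c b) (x y : B →₀ ℝ) :
    M.eulerForm a x y = M.eulerForm b x y := by
  induction b generalizing J c a with
  | nil =>
    have : a = [] := List.eq_nil_iff_forall_not_mem.2 fun k hk => by
      rw [ha.mem_iff, ← hb.mem_iff] at hk; simp at hk
    rw [this]
  | cons s d ih =>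
    obtain ⟨e, he, hE⟩ := ha.exists_cons hb.isInitialLetter
    have hperm : e.Perm d := (List.perm_ext_iff_of_nodup he.tail.nodup hb.tail.nodup).2
      fun k => by rw [he.tail.mem_iff, hb.tail.mem_iff]
    rw [hE, CoxeterMatrix.eulerForm, CoxeterMatrix.eulerForm, ih he.tail hb.tail,
      (hperm.map fun r => x r * M.pairing r s).sum_eq]

theorem Aligned.congr_word {J : Set B} {c : W} {a b : List B}
    (ha : cs.IsCoxeterWord J c a) (hb : cs.IsCoxeterWord J c b) {w : W} (h : cs.Aligned a w) :
    cs.Aligned b w :=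
  h.of_supported {k | k ∈ a} h.supported (fun k hk => by rwa [hb.mem_iff, ← ha.mem_iff])
    fun β γ _ _ => by
      rw [CoxeterMatrix.omega, CoxeterMatrix.omega, ha.eulerForm_eq hb, ha.eulerForm_eq hb]

/-! ### The downward projection -/

variable (cs) in
/-- `v` is the largest aligned element weakly below `w`. -/
structure IsMaxAligned (a : List B) (w v : W) : Prop where
  aligned : cs.Aligned a v
  le : cs.WeakLE v w
  max : ∀ x, cs.Aligned a x → cs.WeakLE x w → cs.WeakLE x v

theorem WeakLE.antisymm {v w : W} (h : cs.WeakLE v w) (h' : cs.WeakLE w v) : v = w :=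
  h.eq_of_length_le h'.length_le

theorem IsMaxAligned.unique {a : List B} {w v v' : W} (h : cs.IsMaxAligned a w v)
    (h' : cs.IsMaxAligned a w v') : v = v' :=
  (h'.max v h.aligned h.le).antisymm (h.max v' h'.aligned h'.le)

theorem IsMaxAligned.congr_word {J : Set B} {c : W} {a b : List B}
    (ha : cs.IsCoxeterWord J c a) (hb : cs.IsCoxeterWord J c b) {w v : W}
    (h : cs.IsMaxAligned a w v) : cs.IsMaxAligned b w v :=
  ⟨h.aligned.congr_word ha hb, h.le, fun x hx => h.max x (hx.congr_word hb ha)⟩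

/-- The element s is itself aligned and below w, so the largest aligned z below w has α_s as an
inversion. Then sz is aligned for the rotated word and below sw, hence below v, and multiplying by s
compares z with sv. Any other aligned element, whether above s or not, lies below z. -/
theorem IsMaxAligned.shorten {s : B} {d : List B} (hn : (s :: d).Nodup) {w v : W}
    (hw : cs.IsLeftDescent w s) (h : cs.IsMaxAligned (d ++ [s]) (cs.simple s * w) v) :
    cs.IsMaxAligned (s :: d) w (cs.simple s * v) := by
  have hsw := simpleRoot_mem_inversions_iff.2 hw
  have hsw' : simpleRoot s ∉ cs.inversions (cs.simple s * w) := by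
    rw [simpleRoot_mem_inversions_simple_mul_iff, not_not]; exact hsw
  have hle := weakLE_iff_inversions_subset.1 h.le
  have hsv : simpleRoot s ∉ cs.inversions v := fun hc => hsw' (hle hc)
  have hsv' : simpleRoot s ∈ cs.inversions (cs.simple s * v) := by
    rwa [simpleRoot_mem_inversions_simple_mul_iff]
  refine ⟨Aligned.of_rotate hn hsv' (by simpa using h.aligned), ?_, fun x hx hxw => ?_⟩
  · have := inversions_simple_mul_subset (s := s) (by simp [hsv, hsw']) hle
    rw [simple_mul_simple_cancel_left] at this
    exact weakLE_iff_inversions_subset.2 this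
  · obtain ⟨z, hz, hzw, hmax⟩ := exists_max_aligned (cs := cs) hn w
    have hsz : simpleRoot s ∈ cs.inversions z := by
      have := weakLE_iff_inversions_subset.1 (hmax _ (aligned_simple (a := s :: d) (s := s)
        (by simp)) (weakLE_iff_inversions_subset.2 (by rw [inversions_simple]; simpa using hsw)))
      exact this (by rw [inversions_simple]; rfl)
    have hszs : simpleRoot s ∉ cs.inversions (cs.simple s * z) := by
      rw [simpleRoot_mem_inversions_simple_mul_iff, not_not]; exact hsz
    have h1 := weakLE_iff_inversions_subset.1 (h.max _ (hz.rotate hn hsz)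
      (weakLE_iff_inversions_subset.2 (inversions_simple_mul_subset (by simp [hsz, hsw])
        (weakLE_iff_inversions_subset.1 hzw))))
    have h2 := inversions_simple_mul_subset (s := s) (by simp [hsv, hszs]) h1
    rw [simple_mul_simple_cancel_left] at h2
    exact (hmax x hx hxw).trans (weakLE_iff_inversions_subset.2 h2)

/-- An aligned element below w does not have α_s as an inversion, so by `Aligned.tail` its
inversions are supported on d; it is therefore below the parabolic part u. -/
theorem IsMaxAligned.restrict {s : B} {d : List B} (hn : (s :: d).Nodup) {w u v : W}
    (hw : ¬ cs.IsLeftDescent w s) (hu : cs.IsParabolicPart {k | k ∈ d} w u)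
    (h : cs.IsMaxAligned d u v) : cs.IsMaxAligned (s :: d) w v := by
  obtain ⟨hs, hd⟩ := List.nodup_cons.1 hn
  refine ⟨h.aligned.cons hs, h.le.trans (weakLE_iff_inversions_subset.2 fun β hβ =>
    (hu.mem_inversions_iff.1 hβ).1), fun x hx hxw => ?_⟩
  rw [weakLE_iff_inversions_subset] at hxw
  have hxd := hx.tail hn fun hc => hw (simpleRoot_mem_inversions_iff.1 (hxw hc))
  exact h.max x hxd (weakLE_iff_inversions_subset.2 fun β hβ =>
    hu.mem_inversions_iff.2 ⟨hxw hβ, hxd.supported β hβ⟩)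

theorem PiDown.isMaxAligned {J : Set B} {c w v : W} (h : cs.PiDown J c w v) {a : List B}
    (ha : cs.IsCoxeterWord J c a) : cs.IsMaxAligned a w v := by
  induction h generalizing a with
  | one J c => exact ⟨aligned_one a, Relation.ReflTransGen.refl, fun x _ h => h⟩
  | shorten J c w v i hi hw _ ih =>
    obtain ⟨d, hd, -⟩ := ha.exists_cons hi
    exact ((ih hd.rotate).shorten hd.nodup hw).congr_word hd ha
  | restrict J c w u v i hi hw hu _ ih =>
    obtain ⟨d, hd, -⟩ := ha.exists_cons hi
    have hJ : J \ {i} = {k | k ∈ d} := Set.ext fun k => (hd.tail.mem_iff k).symm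
    rw [hJ] at hu
    refine ((ih hd.tail).restrict hd.nodup ?_ hu).congr_word hd ha
    unfold IsLeftDescent
    omega

/-- The recursion terminates: one clause shortens the element, the other shortens the word without
lengthening the element. -/
theorem exists_piDown {J : Set B} {c : W} {a : List B} (ha : cs.IsCoxeterWord J c a) {w : W}
    (hw : w ∈ cs.parabolic J) : ∃ v, cs.PiDown J c w v := by
  induction hN : a.length + cs.length w using Nat.strong_induction_on generalizing J c a w with
  | _ N IH =>
  subst hN
  cases a with
  | nil =>
    have : w = 1 := eq_one_of_inversions_eq_empty (cs := cs) (by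
      refine Set.eq_empty_iff_forall_notMem.2 fun β hβ => hβ.1.ne_zero ?_
      exact Finsupp.ext fun k => apply_eq_zero_of_mem_inversions hw hβ
        fun hc => by simpa using (ha.mem_iff k).2 hc)
    exact ⟨1, by rw [this]; exact .one J c⟩
  | cons s d =>
    have hsJ : s ∈ J := (ha.mem_iff s).1 (by simp)
    by_cases hs : cs.IsLeftDescent w s
    · obtain ⟨v, hv⟩ := IH _ (by
        have := cs.isLeftDescent_iff.1 hs
        simp only [List.length_append, List.length_cons, List.length_nil]
        omega) ha.rotate (mul_mem (simple_mem_parabolic hsJ) hw) rfl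
      exact ⟨_, .shorten J c w v s ha.isInitialLetter hs hv⟩
    · obtain ⟨u, hu, z, hz, hz'⟩ := cs.exists_parabolic_factorization (J \ {s}) w
      have hpart : cs.IsParabolicPart (J \ {s}) w u := ⟨hu, z, hz, hz'⟩
      have hul : cs.length u ≤ cs.length w :=
        (weakLE_iff_inversions_subset.2 fun β hβ => (hpart.mem_inversions_iff.1 hβ).1).length_le
      obtain ⟨v, hv⟩ := IH _ (by simp; omega) ha.tail hu rfl
      refine ⟨v, .restrict J c w u v s ha.isInitialLetter ?_ hpart hv⟩
      rw [not_isLeftDescent_iff] at hs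
      omega

/-! ### Greedy words and the recursion -/

variable (cs) in
/-- `p` lists the positions, from `o` on, of the letters of `x` chosen by the greedy algorithm
that strips left descents off `w`. -/
def IsGreedy (x : ℕ → B) : ℕ → W → List ℕ → Prop
  | _, w, [] => w = 1
  | o, w, m :: p => o ≤ m ∧ (∀ j, o ≤ j → j < m → ¬ cs.IsLeftDescent w (x j)) ∧
      cs.IsLeftDescent w (x m) ∧ IsGreedy x (m + 1) (cs.simple (x m) * w) p

section Greedy

variable {x : ℕ → B}

theorem exists_isGreedy (hx : ∀ o i, ∃ m, o ≤ m ∧ x m = i) (o : ℕ) (w : W) :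
    ∃ p, cs.IsGreedy x o w p := by
  classical
  induction hl : cs.length w using Nat.strong_induction_on generalizing o w with
  | _ l IH =>
  by_cases hw : w = 1
  · exact ⟨[], hw⟩
  obtain ⟨i, hi⟩ := cs.exists_leftDescent_of_ne_one hw
  have hex : ∃ m, o ≤ m ∧ cs.IsLeftDescent w (x m) := by
    obtain ⟨m, hm, rfl⟩ := hx o i
    exact ⟨m, hm, hi⟩
  obtain ⟨h1, h2⟩ := Nat.find_spec hex
  obtain ⟨p, hp⟩ := IH _ (by
    have := cs.isLeftDescent_iff.1 h2; omega) (Nat.find hex + 1)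
    (cs.simple (x (Nat.find hex)) * w) rfl
  exact ⟨_ :: p, h1, fun j hj hj' hd => Nat.find_min hex hj' ⟨hj, hd⟩, h2, hp⟩

theorem IsGreedy.le_of_mem {o : ℕ} {w : W} {p : List ℕ} (h : cs.IsGreedy x o w p) :
    ∀ m ∈ p, o ≤ m := by
  induction p generalizing o w with
  | nil => simp
  | cons m p ih =>
    obtain ⟨h1, -, -, h4⟩ := h
    intro k hk
    rcases List.mem_cons.1 hk with rfl | hk
    · exact h1
    · have := ih h4 k hk
      omega

theorem IsGreedy.pairwise {o : ℕ} {w : W} {p : List ℕ} (h : cs.IsGreedy x o w p) :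
    p.Pairwise (· < ·) := by
  induction p generalizing o w with
  | nil => exact .nil
  | cons m p ih => exact .cons (fun k hk => h.2.2.2.le_of_mem k hk) (ih h.2.2.2)

theorem IsGreedy.wordProd_eq {o : ℕ} {w : W} {p : List ℕ} (h : cs.IsGreedy x o w p) :
    cs.wordProd (p.map x) = w := by
  induction p generalizing o w with
  | nil => simpa using h.symm
  | cons m p ih =>
    rw [List.map_cons, wordProd_cons, ih h.2.2.2, simple_mul_simple_cancel_left]

theorem IsGreedy.isReduced {o : ℕ} {w : W} {p : List ℕ} (h : cs.IsGreedy x o w p) :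
    cs.IsReduced (p.map x) := by
  induction p generalizing o w with
  | nil => simp [IsReduced]
  | cons m p ih =>
    have h1 := ih h.2.2.2
    rw [IsReduced, h.2.2.2.wordProd_eq] at h1
    rw [IsReduced, h.wordProd_eq, ← cs.isLeftDescent_iff.1 h.2.2.1, h1]
    simp

theorem isLeftDescent_of_isReduced_cons {i : B} {ω : List B} (h : cs.IsReduced (i :: ω)) :
    cs.IsLeftDescent (cs.wordProd (i :: ω)) i := by
  rw [IsLeftDescent, h.eq, wordProd_cons, simple_mul_simple_cancel_left]
  have := cs.length_wordProd_le ω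
  simp only [List.length_cons]
  omega

/-- The first letter of a reduced word is a left descent, so no reduced subword can start before the
greedy choice. -/
theorem IsGreedy.eq_or_lex {o : ℕ} {w : W} {p q : List ℕ} (h : cs.IsGreedy x o w p)
    (hq : q.Pairwise (· < ·)) (ho : ∀ m ∈ q, o ≤ m) (hr : cs.IsReduced (q.map x))
    (hw : cs.wordProd (q.map x) = w) : p = q ∨ List.Lex (· < ·) p q := by
  induction p generalizing o w q with
  | nil =>
    cases q with
    | nil => exact Or.inl rfl
    | cons m q => exact Or.inr .nil
  | cons m p ih =>
    obtain ⟨h1, h2, h3, h4⟩ := h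
    cases q with
    | nil =>
      rw [List.map_nil, wordProd_nil] at hw
      exact absurd (hw ▸ h3) (cs.not_isLeftDescent_one _)
    | cons k q =>
      have hd : cs.IsLeftDescent w (x k) := by
        rw [← hw]; exact isLeftDescent_of_isReduced_cons hr
      have hmk : m ≤ k := by
        by_contra hc
        exact h2 k (ho k (by simp)) (by omega) hd
      rcases hmk.lt_or_eq with hlt | rfl
      · exact Or.inr (.rel hlt)
      · rw [List.pairwise_cons] at hq
        rcases ih h4 hq.2 (fun j hj => hq.1 j hj) (hr.drop 1) (by
            rw [← hw, List.map_cons, wordProd_cons, simple_mul_simple_cancel_left]) with h | h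
        · exact Or.inl (by rw [h])
        · exact Or.inr (.cons h)

theorem IsGreedy.step {o : ℕ} {w : W} {p : List ℕ} (h : cs.IsGreedy x o w p) :
    (∃ p', p = o :: p' ∧ cs.IsLeftDescent w (x o) ∧
      cs.IsGreedy x (o + 1) (cs.simple (x o) * w) p') ∨
    (o ∉ p ∧ ¬ cs.IsLeftDescent w (x o) ∧ cs.IsGreedy x (o + 1) w p) := by
  cases p with
  | nil =>
    right
    have hw : w = 1 := h
    subst hw
    exact ⟨by simp, cs.not_isLeftDescent_one _, rfl⟩
  | cons m p =>
    obtain ⟨h1, h2, h3, h4⟩ := h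
    rcases h1.eq_or_lt with rfl | hlt
    · exact Or.inl ⟨p, rfl, h3, h4⟩
    · refine Or.inr ⟨fun hc => ?_, h2 o le_rfl hlt, hlt, fun j hj => h2 j (by omega), h3, h4⟩
      rcases List.mem_cons.1 hc with rfl | hc
      · omega
      · have := h4.le_of_mem o hc
        omega

/-- The letters that may still be used from position `o` on, when a letter skipped once may not be
used any more. -/
def aliveWord (x : ℕ → B) (n : ℕ) (p : List ℕ) (o : ℕ) : List B :=
  ((List.range' o n).filter fun j => j < n ∨ j - n ∈ p).map x

/-- The letters of `aliveWord` after position `o`. -/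
def aliveTail (x : ℕ → B) (n : ℕ) (p : List ℕ) (o : ℕ) : List B :=
  ((List.range' (o + 1) (n - 1)).filter fun j => j < n ∨ j - n ∈ p).map x

theorem aliveWord_eq {n : ℕ} (hn : 0 < n) (p : List ℕ) (o : ℕ) :
    aliveWord x n p o =
      if o < n ∨ o - n ∈ p then x o :: aliveTail x n p o else aliveTail x n p o := by
  obtain ⟨n, rfl⟩ : ∃ n', n = n' + 1 := ⟨n - 1, by omega⟩
  simp only [aliveWord, aliveTail, List.range'_succ, List.filter_cons, Nat.add_sub_cancel,
    decide_eq_true_eq]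
  by_cases h : o < n + 1 ∨ o - (n + 1) ∈ p
  · rw [if_pos h, if_pos h, List.map_cons]
  · rw [if_neg h, if_neg h]

/-- When the window slides by one, position o + n enters with the same letter as o, and it is alive
exactly when o was used. -/
theorem aliveWord_succ_eq {n : ℕ} (hn : 0 < n) (hx : ∀ m, x (m + n) = x m) (p : List ℕ) (o : ℕ) :
    aliveWord x n p (o + 1) =
      if o ∈ p then aliveTail x n p o ++ [x o] else aliveTail x n p o := by
  obtain ⟨n, rfl⟩ : ∃ n', n = n' + 1 := ⟨n - 1, by omega⟩
  have h := hx o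
  rw [show o + (n + 1) = o + 1 + n by ring] at h
  simp only [aliveWord, aliveTail, List.range'_1_concat, List.filter_append, List.map_append,
    Nat.add_sub_cancel, List.filter_cons, List.filter_nil]
  have h1 : ¬ (o + 1 + n < n + 1) := by omega
  have h2 : o + 1 + n - (n + 1) = o := by omega
  rw [h2]
  by_cases hp : o ∈ p <;> simp [hp, h, h1]

theorem not_mem_aliveTail {n : ℕ} (hx : ∀ i j, i < j → j < i + n → x i ≠ x j) (p : List ℕ)
    (o : ℕ) : x o ∉ aliveTail x n p o := by
  intro hc
  obtain ⟨j, hj, hj'⟩ := List.mem_map.1 hc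
  have := List.mem_range'_1.1 (List.mem_filter.1 hj).1
  exact hx o j (by omega) (by omega) hj'.symm

/-- Scanning one position rotates the alive word if the position is used, and drops its first letter
if an alive position is skipped: these are the constructors `use` and `skip`. Closure of p under
subtracting n ensures that used positions are alive. -/
theorem IsGreedy.recSortable_aliveWord {n : ℕ} (hn : 0 < n) (hx : ∀ m, x (m + n) = x m)
    {p : List ℕ} (hp : ∀ m ∈ p, n ≤ m → m - n ∈ p) {o : ℕ} {w : W} {q : List ℕ}
    (h : cs.IsGreedy x o w q) (hq : ∀ m, o ≤ m → (m ∈ q ↔ m ∈ p)) :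
    cs.RecSortable (aliveWord x n p o) w := by
  obtain ⟨k, hk⟩ : ∃ k, ∀ m ∈ q, m < o + k := by
    -- Any bound on the remaining positions serves as fuel; the sum dominates each entry.
    refine ⟨q.sum + 1, fun m hm => ?_⟩
    have := List.single_le_sum (l := q) (fun _ _ => Nat.zero_le _) m hm
    omega
  induction k generalizing o w q with
  | zero =>
    cases q with
    | nil => rw [show w = 1 from h]; exact .one _
    | cons m q =>
      have h1 := hk m (by simp)
      have h2 := h.le_of_mem m (by simp)
      omega
  | succ k ih =>
    rw [aliveWord_eq hn]
    rcases h.step with ⟨q', rfl, hd, hg⟩ | ⟨hoq, hd, hg⟩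
    · have hop : o ∈ p := (hq o le_rfl).1 (by simp)
      have hal : o < n ∨ o - n ∈ p := by
        by_cases ho : o < n
        · exact Or.inl ho
        · exact Or.inr (hp o hop (by omega))
      have := ih hg (fun m hm => by
        rw [← hq m (by omega), List.mem_cons]
        constructor
        · exact Or.inr
        · rintro (rfl | h)
          · omega
          · exact h) (fun m hm => by
        have := hk m (by simp [hm]); omega)
      rw [aliveWord_succ_eq hn hx, if_pos hop] at this
      rw [if_pos hal]
      exact .use _ _ _ hd this
    · have hop : o ∉ p := fun hc => hoq ((hq o le_rfl).2 hc)
      have := ih hg (fun m hm => hq m (by omega)) (fun m hm => by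
        have := hk m hm; omega)
      rw [aliveWord_succ_eq hn hx, if_neg hop] at this
      split_ifs
      · exact .skip _ _ _ this
      · exact this

/-- An element sortable for the alive tail lies in a parabolic subgroup omitting the current letter,
so that letter is no left descent of it. This decides which constructor was applied, and a used
position must be alive. -/
theorem IsGreedy.sub_mem_of_recSortable {n : ℕ} (hn : 0 < n) (hx : ∀ m, x (m + n) = x m)
    (hinj : ∀ i j, i < j → j < i + n → x i ≠ x j) {w : W} {p : List ℕ}
    (h : cs.IsGreedy x 0 w p) (hs : cs.RecSortable (aliveWord x n p 0) w) :
    ∀ m ∈ p, n ≤ m → m - n ∈ p := by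
  suffices H : ∀ o, ∃ q v, cs.IsGreedy x o v q ∧ (∀ m, o ≤ m → (m ∈ q ↔ m ∈ p)) ∧
      cs.RecSortable (aliveWord x n p o) v ∧ ∀ m ∈ p, m < o → n ≤ m → m - n ∈ p by
    intro m hm hnm
    obtain ⟨_, _, _, _, _, H⟩ := H (m + 1)
    exact H m hm (by omega) hnm
  intro o
  induction o with
  | zero => exact ⟨p, w, h, fun _ _ => Iff.rfl, hs, fun m _ hm => absurd hm (by omega)⟩
  | succ o ih =>
    obtain ⟨q, v, hg, hq, hv, hcl⟩ := ih
    rw [aliveWord_eq hn] at hv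
    have htail : ∀ v', cs.RecSortable (aliveTail x n p o) v' → ¬ cs.IsLeftDescent v' (x o) := by
      intro v' hv' hd
      have := apply_eq_zero_of_mem_inversions hv'.mem_parabolic
        (simpleRoot_mem_inversions_iff.2 hd) (not_mem_aliveTail hinj p o)
      simp at this
    rcases hg.step with ⟨q', rfl, hd, hg'⟩ | ⟨hoq, hd, hg'⟩
    · have hop : o ∈ p := (hq o le_rfl).1 (by simp)
      have hal : o < n ∨ o - n ∈ p := by
        by_contra hc
        rw [if_neg hc] at hv
        exact htail v hv hd
      refine ⟨q', _, hg', fun m hm => ?_, ?_, fun m hm hmo hnm => ?_⟩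
      · rw [← hq m (by omega), List.mem_cons]
        constructor
        · exact Or.inr
        · rintro (rfl | h)
          · omega
          · exact h
      · rw [aliveWord_succ_eq hn hx, if_pos hop]
        rw [if_pos hal] at hv
        cases hv with
        | one => exact absurd hd (cs.not_isLeftDescent_one _)
        | use _ _ _ _ h => exact h
        | skip _ _ _ h => exact absurd hd (htail v h)
      · rcases Nat.lt_succ_iff_lt_or_eq.1 hmo with hlt | rfl
        · exact hcl m hm hlt hnm
        · exact hal.resolve_left (by omega)
    · have hop : o ∉ p := fun hc => hoq ((hq o le_rfl).2 hc)
      refine ⟨q, v, hg', fun m hm => hq m (by omega), ?_, fun m hm hmo hnm => ?_⟩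
      · rw [aliveWord_succ_eq hn hx, if_neg hop]
        split_ifs at hv
        · cases hv with
          | one => exact .one _
          | use _ _ _ h _ => exact absurd h hd
          | skip _ _ _ h => exact h
        · exact hv
      · rcases Nat.lt_succ_iff_lt_or_eq.1 hmo with hlt | rfl
        · exact hcl m hm hlt hnm
        · exact absurd hm hop

theorem IsGreedy.closed_iff_recSortable {n : ℕ} (hn : 0 < n) (hx : ∀ m, x (m + n) = x m)
    (hinj : ∀ i j, i < j → j < i + n → x i ≠ x j) {w : W} {p : List ℕ}
    (h : cs.IsGreedy x 0 w p) :
    (∀ m ∈ p, n ≤ m → m - n ∈ p) ↔ cs.RecSortable ((List.range n).map x) w := by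
  have h0 : aliveWord x n p 0 = (List.range n).map x := by
    rw [aliveWord, List.range_eq_range', List.filter_eq_self.2]
    intro j hj
    have := List.mem_range'_1.1 hj
    simp; omega
  rw [← h0]
  exact ⟨fun hp => h.recSortable_aliveWord hn hx hp fun _ _ => Iff.rfl,
    fun hs => h.sub_mem_of_recSortable hn hx hinj hs⟩

end Greedy

/-! ### Sorting words as greedy words -/

section Positions

variable {a : List B}

/-- The `m`-th position in the half-infinite word `a | a | a | ⋯`. -/
def positionAt (ha : 0 < a.length) (m : ℕ) : Position a :=
  toLex (m / a.length, ⟨m % a.length, Nat.mod_lt m ha⟩)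

/-- The number of positions before a given one. -/
def positionIndex (P : Position a) : ℕ :=
  (ofLex P).1 * a.length + (ofLex P).2

/-- The `m`-th letter of the half-infinite word `a | a | a | ⋯`. -/
def letterAt (ha : 0 < a.length) (m : ℕ) : B :=
  a.get ⟨m % a.length, Nat.mod_lt m ha⟩

theorem positionAt_positionIndex (ha : 0 < a.length) (P : Position a) :
    positionAt ha (positionIndex P) = P := by
  obtain ⟨k, r, hr⟩ := P
  simp only [positionAt, positionIndex]
  change toLex ((k * a.length + r) / a.length,
    (⟨(k * a.length + r) % a.length, _⟩ : Fin a.length)) = toLex (k, ⟨r, hr⟩)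
  have h1 : (k * a.length + r) / a.length = k := by
    rw [mul_comm, Nat.mul_add_div ha, Nat.div_eq_of_lt hr, add_zero]
  have h2 : (k * a.length + r) % a.length = r := by
    rw [mul_comm, Nat.mul_add_mod, Nat.mod_eq_of_lt hr]
  simp only [h1, h2]

theorem positionAt_strictMono (ha : 0 < a.length) : StrictMono (positionAt ha) := by
  intro m k hmk
  rw [Prod.Lex.lt_iff]
  change m / a.length < k / a.length ∨ m / a.length = k / a.length ∧ m % a.length < k % a.length
  rcases (Nat.div_le_div_right (c := a.length) hmk.le).lt_or_eq with h | h
  · exact Or.inl h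
  · refine Or.inr ⟨h, ?_⟩
    have h1 := Nat.div_add_mod m a.length
    have h2 := Nat.div_add_mod k a.length
    rw [h] at h1
    omega

theorem positionIndex_strictMono (ha : 0 < a.length) :
    StrictMono (positionIndex : Position a → ℕ) := fun P Q h => by
  rwa [← (positionAt_strictMono ha).lt_iff_lt, positionAt_positionIndex, positionAt_positionIndex]

theorem lex_map_of_strictMono {α β : Type*} [Preorder α] [Preorder β] {f : α → β}
    (hf : StrictMono f) {p q : List α} (h : List.Lex (· < ·) p q) :
    List.Lex (· < ·) (p.map f) (q.map f) := by
  induction h with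
  | nil => exact .nil
  | cons _ ih => exact .cons ih
  | rel h => exact .rel (hf h)

theorem IsSortingWord.unique {w : W} {p q : List (Position a)} (hp : cs.IsSortingWord a w p)
    (hq : cs.IsSortingWord a w q) : p = q := by
  rcases hp.2 q hq.1 with h | h
  · exact h
  rcases hq.2 p hp.1 with h' | h'
  · exact h'.symm
  exact absurd h' (List.lex_asymm (fun h1 => lt_asymm h1) h)

theorem positionsWord_map_positionAt (ha : 0 < a.length) (p : List ℕ) :
    positionsWord a (p.map (positionAt ha)) = p.map (letterAt ha) := by
  rw [positionsWord, List.map_map]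
  rfl

theorem IsGreedy.isSortingWord (ha : 0 < a.length) {w : W} {p : List ℕ}
    (h : cs.IsGreedy (letterAt ha) 0 w p) : cs.IsSortingWord a w (p.map (positionAt ha)) := by
  refine ⟨⟨h.pairwise.map _ fun _ _ hmk => positionAt_strictMono ha hmk, ?_, ?_⟩, fun q hq => ?_⟩
  · rw [positionsWord_map_positionAt]; exact h.isReduced
  · rw [positionsWord_map_positionAt]; exact h.wordProd_eq
  have hq1 : (q.map positionIndex).map (positionAt ha) = q := by
    rw [List.map_map]
    exact (List.map_congr_left fun P _ => positionAt_positionIndex ha P).trans (List.map_id q)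
  have hq2 : (q.map positionIndex).map (letterAt ha) = positionsWord a q := by
    rw [← positionsWord_map_positionAt, hq1]
  rcases h.eq_or_lex (hq.increasing.map _ fun _ _ hPQ => positionIndex_strictMono ha hPQ)
    (fun _ _ => Nat.zero_le _) (by rw [hq2]; exact hq.reduced)
    (by rw [hq2]; exact hq.prod_eq) with h1 | h1
  · exact Or.inl (by rw [h1, hq1])
  · exact Or.inr (hq1 ▸ lex_map_of_strictMono (positionAt_strictMono ha) h1)

theorem letterAt_add_length (ha : 0 < a.length) (m : ℕ) :
    letterAt ha (m + a.length) = letterAt ha m := by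
  simp [letterAt]

theorem map_letterAt_range (ha : 0 < a.length) :
    (List.range a.length).map (letterAt ha) = a := by
  apply List.ext_getElem
  · simp
  · intro k h1 h2
    simp [letterAt, Nat.mod_eq_of_lt h2]

theorem letterAt_ne (hn : a.Nodup) (ha : 0 < a.length) {i j : ℕ} (h1 : i < j)
    (h2 : j < i + a.length) : letterAt ha i ≠ letterAt ha j := by
  intro h
  have h3 := Fin.mk.inj_iff.1 (List.nodup_iff_injective_get.1 hn h)
  have h4 := Nat.div_add_mod i a.length
  have h5 := Nat.div_add_mod j a.length
  have h6 : i / a.length = j / a.length := by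
    rcases (Nat.div_le_div_right (c := a.length) h1.le).lt_or_eq with h | h
    · have := Nat.mul_le_mul_left a.length (Nat.succ_le_of_lt h)
      rw [Nat.mul_succ] at this
      omega
    · exact h
  rw [h6] at h4
  omega

theorem exists_letterAt_eq (ha : 0 < a.length) (o : ℕ) {i : B} (hi : i ∈ a) :
    ∃ m, o ≤ m ∧ letterAt ha m = i := by
  obtain ⟨r, rfl⟩ := List.get_of_mem hi
  refine ⟨a.length * o + r, ?_, ?_⟩
  · exact (Nat.le_mul_of_pos_left o ha).trans (Nat.le_add_right _ _)
  · simp only [letterAt, Nat.mul_add_mod, Nat.mod_eq_of_lt r.2]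

/-- Going back one copy of the word means subtracting its length from the position; since letters do
not repeat, a letter determines its position within a copy. -/
theorem block_antitone_iff (hn : a.Nodup) (ha : 0 < a.length) {p : List ℕ} :
    (∀ k, block a (p.map (positionAt ha)) (k + 1) ⊆ block a (p.map (positionAt ha)) k) ↔
      ∀ m ∈ p, a.length ≤ m → m - a.length ∈ p := by
  have hmem (m : ℕ) : positionAt ha m ∈ p.map (positionAt ha) ↔ m ∈ p :=
    List.mem_map_of_injective (positionAt_strictMono ha).injective
  constructor
  · intro h m hm hlt
    obtain ⟨m, rfl⟩ := Nat.exists_eq_add_of_le' hlt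
    rw [Nat.add_sub_cancel]
    have h1 : letterAt ha m ∈ block a (p.map (positionAt ha)) (m / a.length + 1) := by
      refine ⟨⟨m % a.length, Nat.mod_lt m ha⟩, ?_, rfl⟩
      have := (hmem _).2 hm
      simpa only [positionAt, Nat.add_div_right _ ha, Nat.add_mod_right] using this
    obtain ⟨r, hr, hr'⟩ := h _ h1
    obtain rfl := List.nodup_iff_injective_get.1 hn hr'
    exact (hmem m).1 hr
  · rintro h k _ ⟨r, hr, rfl⟩
    refine ⟨r, ?_, rfl⟩
    rw [← positionAt_positionIndex ha (toLex (k + 1, r)), hmem] at hr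
    rw [← positionAt_positionIndex ha (toLex (k, r)), hmem]
    have h1 : positionIndex (toLex (k + 1, r) : Position a)
        = positionIndex (toLex (k, r) : Position a) + a.length := by
      change (k + 1) * a.length + r = k * a.length + r + a.length
      ring
    rw [h1] at hr
    have := h _ hr (Nat.le_add_left _ _)
    rwa [Nat.add_sub_cancel] at this

theorem exists_isSortingWord_iff_aligned {c : W} (hc : cs.IsCoxeterWord Set.univ c a) {w : W} :
    (∃ p, cs.IsSortingWord a w p ∧ ∀ k, block a p (k + 1) ⊆ block a p k) ↔ cs.Aligned a w := by
  rcases Nat.eq_zero_or_pos a.length with h0 | ha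
  · obtain rfl := List.eq_nil_of_length_eq_zero h0
    -- An empty word for c means there are no generators, so the group is trivial and there are no
    -- positions.
    have : IsEmpty B := ⟨fun i => by simpa using hc.mem_iff i⟩
    have hw : w = 1 := by
      obtain ⟨ω, rfl⟩ := cs.wordProd_surjective w
      rw [Subsingleton.elim ω [], wordProd_nil]
    subst hw
    refine iff_of_true ⟨[], ⟨⟨List.Pairwise.nil, ?_, rfl⟩, fun q _ => ?_⟩, fun k => ?_⟩
      (aligned_one _)
    · simp [positionsWord, IsReduced]
    · exact Or.inl (List.eq_nil_iff_forall_not_mem.2 fun P _ => (ofLex P).2.elim0).symm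
    · rintro i -
      exact isEmptyElim i
  · obtain ⟨p, hp⟩ := cs.exists_isGreedy
      (fun o i => exists_letterAt_eq ha o ((hc.mem_iff i).2 (Set.mem_univ i))) 0 w
    have hs := hp.isSortingWord ha
    have h1 : cs.Aligned a w ↔ cs.RecSortable a w :=
      ⟨Aligned.recSortable hc.nodup, RecSortable.aligned hc.nodup⟩
    have h2 := hp.closed_iff_recSortable ha (letterAt_add_length ha)
      fun i j => letterAt_ne hc.nodup ha
    rw [map_letterAt_range] at h2
    rw [h1, ← h2, ← block_antitone_iff hc.nodup ha]
    constructor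
    · rintro ⟨q, hq, hq'⟩
      rwa [hq.unique hs] at hq'
    · exact fun h => ⟨_, hs, h⟩

theorem isSortable_iff_aligned {c : W} (hc : cs.IsCoxeterWord Set.univ c a) {w : W} :
    cs.IsSortable c w ↔ cs.Aligned a w := by
  constructor
  · rintro ⟨b, hb, h⟩
    exact ((exists_isSortingWord_iff_aligned hb).1 h).congr_word hb hc
  · exact fun h => ⟨a, hc, (exists_isSortingWord_iff_aligned hc).2 h⟩

end Positions

end CoxeterSystem

/-! ### The proposition -/

theorem proposition3p2 {B W : Type*} [Group W] [Finite W] {M : CoxeterMatrix B}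
    (cs : CoxeterSystem M W) (c : W) (hc : cs.IsCoxeterElement Set.univ c) :
    ∃ π : W → W,
      -- the recursion has exactly one value at each `w`, for all choices of initial letters
      (∀ w v : W, cs.PiDown Set.univ c w v ↔ v = π w) ∧
      -- `π w` is the maximum of the `c`-sortable elements weakly below `w`
      (∀ w : W, cs.IsSortable c (π w) ∧ cs.WeakLE (π w) w ∧
        ∀ x : W, cs.IsSortable c x → cs.WeakLE x w → cs.WeakLE x (π w)) ∧
      -- and it is the only maximal one
      (∀ w y : W, cs.IsSortable c y → cs.WeakLE y w →
        (∀ x : W, cs.IsSortable c x → cs.WeakLE x w → cs.WeakLE y x → x = y) → y = π w) ∧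
      (∀ w : W, π (π w) = π w) ∧
      (∀ x y : W, cs.WeakLE x y → cs.WeakLE (π x) (π y)) := by
  obtain ⟨a, ha⟩ := hc
  have huniv (w : W) : w ∈ cs.parabolic Set.univ := by
    rw [CoxeterSystem.parabolic, Set.image_univ, cs.subgroup_closure_range_simple]
    exact Subgroup.mem_top w
  choose π hπ using fun w => CoxeterSystem.exists_piDown ha (huniv w)
  have hmax (w : W) : cs.IsMaxAligned a w (π w) := (hπ w).isMaxAligned ha
  -- With sortability replaced by alignment, each claim follows from `π w` being the largest aligned
  -- element below w.
  simp only [CoxeterSystem.isSortable_iff_aligned ha]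
  refine ⟨π, fun w v => ⟨fun h => (h.isMaxAligned ha).unique (hmax w), ?_⟩,
    fun w => ⟨(hmax w).aligned, (hmax w).le, (hmax w).max⟩, fun w y hy hyw h => ?_, fun w => ?_,
    fun x y hxy => ?_⟩
  · rintro rfl
    exact hπ w
  · exact (h (π w) (hmax w).aligned (hmax w).le ((hmax w).max y hy hyw)).symm
  · exact (hmax (π w)).le.antisymm
      ((hmax (π w)).max _ (hmax w).aligned Relation.ReflTransGen.refl)
  · exact (hmax y).max _ (hmax x).aligned ((hmax x).le.trans hxy)
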